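/- Let $n\ge 0$ be an integer and $\mu\in\mathbb C$. Let $\Gamma_n=\langle b_1,\dots,b_n\mid b_1^2=\cdots=b_n^2=1\rangle$ and let $\Delta$ be its Cayley tree: the vertices are the elements of $\Gamma_n$, and $g,h$ are joined by an edge of colour $i$ iff $h=gb_i$. For $I\subseteq\{1,\dots,n\}$ and a vertex $v$ let $[v;I]$ be the connected component containing $v$ of the graph obtained from $\Delta$ by deleting all edges with colour outside $I$. For $i<j$ let $\mathcal A_{ij}=\{[v;\{i,j\}] : v\in\Gamma_n\}$, let $\mathcal A=\bigsqcup_{i<j}\mathcal A_{ij}$, and let $\mathcal X$ be the set of all $[v;\hat k]$, where $\hat k=\{1,\dots,n\}\setminus\{k\}$. A $\mu$-Hurwitz map is a function $\phi:\mathcal X\to\mathbb C$ such that, for every vertex $v$ and every $i$, with $x_k=\phi([v;\hat k])$, $$\phi([v;\hat i])+\phi([vb_i;\hat i])=\prod_{k\ne i}x_k\qquad\text{and}\qquad \sum_{k=1}^n x_k^2-\prod_{k=1}^n x_k=\mu .$$ For $\gamma=[v;\{i,j\}]\in\mathcal A_{ij}$ put $\phi(\gamma)=\prod_{k\ne i,j}x_k$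 and $\sigma(\gamma)=\sum_{k\neq i,j}x_k^2$; these do not depend on the choice of $v$. Let $\mathcal B_\mu$ be the set of $\mu$-Hurwitz maps $\phi$ such that $\phi(\gamma)\notin[-2,2]$ for all $\gamma\in\mathcal A$, and $\{\gamma\in\mathcal A : |\phi(\gamma)|\le K\}$ is finite for some $K>2$. (For $n\le 2$ no pair of an element of $\mathcal B_\mu$ and weights as below exists; the content is the case $n\ge3$.) Theorem. Let $\phi\in\mathcal B_\mu$ and let $q_{ij}\in\mathbb C$ $(1\le i<j\le n)$ be arbitrary with $\sum_{i<j}q_{ij}=1$. Then $\phi(\gamma)\ne0$ and $\sigma(\gamma)\neq\mu$ for every $\gamma\in\mathcal A$, and $$\sum_{1\le i<j\le n}\ \sum_{\gamma\in\mathcal A_{ij}}\left(1-\Big(1+q_{ij}\,\frac{\mu}{\sigma(\gamma)-\mu}\Big)\sqrt{1-\frac{4}{\phi(\gamma)^2}}\right)=1,$$ where the sum over each $\mathcal A_{ij}$ converges absolutely and the square root is the one with non-negative real part. -/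

import Mathlib

noncomputable section

namespace MarkoffHurwitz

/-- The group `Γ_n = ⟨b_1, …, b_n | b_1² = ⋯ = b_n² = 1⟩`,
the free product of `n` groups of order two. Colours are indexed by `Fin n`. -/
abbrev Gam (n : ℕ) : Type :=
  Monoid.CoprodI (fun _ : Fin n => Multiplicative (ZMod 2))

/-- The generating involution `b_i`. -/
def gen {n : ℕ} (i : Fin n) : Gam n :=
  Monoid.CoprodI.of (M := fun _ : Fin n => Multiplicative (ZMod 2)) (i := i)
    (Multiplicative.ofAdd 1)

theorem gen_mul_gen {n : ℕ} (i : Fin n) : gen i * gen i = 1 := by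
  have h : (Multiplicative.ofAdd (1 : ZMod 2)) * Multiplicative.ofAdd 1 = 1 := by decide
  unfold gen
  rw [← map_mul, h, map_one]

theorem gen_ne_one {n : ℕ} (i : Fin n) : gen i ≠ 1 := by
  intro h
  have h' := Monoid.CoprodI.of_injective (M := fun _ : Fin n => Multiplicative (ZMod 2)) i
    (h.trans (map_one _).symm)
  exact absurd h' (by decide)

/-- The graph on `Γ_n` whose edges are the edges of the Cayley tree `Δ` with colour in `I`:
`g` and `h` are joined by an edge of colour `i` iff `h = g * b_i`.
For `I` the set of all colours this is `Δ` itself. -/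
def colourGraph {n : ℕ} (I : Finset (Fin n)) : SimpleGraph (Gam n) where
  Adj g h := ∃ i ∈ I, h = g * gen i
  symm := by
    refine ⟨?_⟩
    rintro g h ⟨i, hi, rfl⟩
    exact ⟨i, hi, by rw [mul_assoc, gen_mul_gen, mul_one]⟩
  loopless := by
    refine ⟨?_⟩
    rintro g ⟨i, -, h⟩
    exact gen_ne_one i (mul_left_cancel (h.symm.trans (mul_one g).symm))

theorem colourGraph_mono {n : ℕ} {I J : Finset (Fin n)} (h : I ⊆ J) :
    colourGraph I ≤ colourGraph J := by
  rintro g g' ⟨i, hi, hg⟩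
  exact ⟨i, h hi, hg⟩

/-- The `I`-forest of `Δ`: the set of regular subtrees of `Δ` with colour set `I`, that is, the
connected components of what is left of `Δ` when all edges with colour outside `I` are deleted. -/
abbrev RegTree {n : ℕ} (I : Finset (Fin n)) : Type :=
  (colourGraph I).ConnectedComponent

/-- The regular subtree `[v; I]` with colour set `I` through the vertex `v`. -/
def treeAt {n : ℕ} (v : Gam n) (I : Finset (Fin n)) : RegTree I :=
  (colourGraph I).connectedComponentMk v

/-- The unique `J`-regular subtree that contains a given `I`-regular subtree, for `I ⊆ J`. -/
def RegTree.extend {n : ℕ} {I J : Finset (Fin n)} (h : I ⊆ J) (T : RegTree I) : RegTree J :=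
  SimpleGraph.ConnectedComponent.map (SimpleGraph.Hom.ofLE (colourGraph_mono h)) T

/-- A Hurwitz map: a complex-valued function on the regular subtrees of valence `n - 1`
(an element of `RegTree {i}ᶜ` is such a tree that misses exactly the colour `i`) that satisfies the
edge relation across each edge of `Δ`; the edge here has colour `i` and joins `v` to `v * b_i`. -/
structure HurwitzMap (n : ℕ) where
  val : (i : Fin n) → RegTree ({i}ᶜ : Finset (Fin n)) → ℂ
  edge_rel : ∀ (v : Gam n) (i : Fin n),
    val i (treeAt v {i}ᶜ) + val i (treeAt (v * gen i) {i}ᶜ)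
      = ∏ j ∈ ({i}ᶜ : Finset (Fin n)), val j (treeAt v {j}ᶜ)

/-- Pairs of colours `i < j`. -/
abbrev ColourPair (n : ℕ) : Type := {p : Fin n × Fin n // p.1 < p.2}

/-- The colour set `{i, j}` of a pair. -/
def ColourPair.colours {n : ℕ} (p : ColourPair n) : Finset (Fin n) := {p.1.1, p.1.2}

/-- `𝒜_{ij}`: the alternating geodesics with edges coloured `i` and `j`. -/
abbrev AltGeodesicOf {n : ℕ} (p : ColourPair n) : Type := RegTree p.colours

/-- `𝒜`: all alternating geodesics, the disjoint union of the `𝒜_{ij}`, `i < j`. -/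
abbrev AltGeodesic (n : ℕ) : Type := Σ p : ColourPair n, AltGeodesicOf p

namespace HurwitzMap

variable {n : ℕ}

theorem subset_compl_of_notMem {I : Finset (Fin n)} {k : Fin n}
    (hk : k ∉ I) : I ⊆ {k}ᶜ := by
  intro x hx
  simp only [Finset.mem_compl, Finset.mem_singleton]
  rintro rfl
  exact hk hx

/-- The value `x_k = φ(X_k)`, where `X_k ⊇ T` is the subtree of valence `n - 1` that misses
the colour `k`. -/
def coord (φ : HurwitzMap n) {I : Finset (Fin n)} (T : RegTree I) (k : {k : Fin n // k ∉ I}) : ℂ :=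
  φ.val k.1 (T.extend (subset_compl_of_notMem k.2))

/-- The extended Hurwitz map `φ(γ) = ∏_{k ≠ i, j} x_k`. -/
def ext (φ : HurwitzMap n) {p : ColourPair n} (γ : AltGeodesicOf p) : ℂ :=
  ∏ k : {k : Fin n // k ∉ p.colours}, φ.coord γ k

/-- The square sum weight `σ(γ) = ∑_{k ≠ i, j} x_k²`. -/
def sqSum (φ : HurwitzMap n) {p : ColourPair n} (γ : AltGeodesicOf p) : ℂ :=
  ∑ k : {k : Fin n // k ∉ p.colours}, φ.coord γ k ^ 2

/-- `φ` is a `μ`-Hurwitz map: the vertex relation `∑ x_i² - ∏ x_i = μ` holds at every vertex. -/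
def IsMu (φ : HurwitzMap n) (μ : ℂ) : Prop :=
  ∀ v : Gam n,
    ∑ i : Fin n, φ.val i (treeAt v {i}ᶜ) ^ 2 - ∏ i : Fin n, φ.val i (treeAt v {i}ᶜ) = μ

/-- The summand `𝔥_μ(γ, q) = 1 - (1 + q μ / (σ(γ) - μ)) √(1 - 4 / φ(γ)²)`. The principal branch
of the square root is used, so it has non-negative real part. -/
def summand (φ : HurwitzMap n) (μ q : ℂ) {p : ColourPair n} (γ : AltGeodesicOf p) : ℂ :=
  1 - (1 + q * (μ / (φ.sqSum γ - μ))) * (1 - 4 / φ.ext γ ^ 2) ^ (1 / 2 : ℂ)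

end HurwitzMap

/-- The set `ℬ_μ` of `μ`-Hurwitz maps that satisfy the Bowditch conditions
(B1) `φ(γ) ∉ [-2, 2]` for all `γ ∈ 𝒜`, and
(B2) `{γ ∈ 𝒜 : |φ(γ)| ≤ K}` is finite for some `K > 2`. -/
def Bowditch (n : ℕ) (μ : ℂ) : Set (HurwitzMap n) :=
  {φ | φ.IsMu μ ∧
    (∀ γ : AltGeodesic n, ¬ ∃ t : ℝ, t ∈ Set.Icc (-2 : ℝ) 2 ∧ φ.ext γ.2 = (t : ℂ)) ∧
    ∃ K : ℝ, 2 < K ∧ {γ : AltGeodesic n | ‖φ.ext γ.2‖ ≤ K}.Finite}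

end MarkoffHurwitz

end

noncomputable section

namespace MarkoffHurwitz

open Filter Topology

/-! ### Second order linear recurrences -/

/-! Root the tree at the identity. For a vertex and a colour i put u = x_i / ∏_{k≠i} x_k. The edge
relation says that the values of u at the two ends of an edge add up to 1; the vertex relation says
that the values of u at one vertex add up to 1 + μ/∏ x_k. Hence the sum of u over the edges leaving
a ball is 1 + μ Σ 1/∏ x_k, summed over the vertices of the ball (`edgeSum_div_coProd`).

On the other side, η = (1 - √(1 - 4/a²))/2 solves η(1 - η) = 1/a². A geodesic that meets the ball
leaves it through exactly two edges, so summing η(φ(γ)) over the leaving edges and the geodesics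
through them counts each geodesic met by the ball twice (`edgeSum_eta`). On each edge, u and the sum
of the η nearly solve the same quadratic equation. Far out their difference is at most a constant
times an edge weight (`exists_norm_defect_le`), and the total weight of a level decays geometrically
(`summable_edgeWeight`). In the limit, Σ_γ 2η(φ(γ)) = 1 + μ Σ_v 1/∏ x_k (`tsum_newSum`).

For each pair i < j the vertices are partitioned by the geodesics in 𝒜_{ij}, and along a geodesic
1/∏ x_k telescopes to √(1 - 4/φ²)/(σ - μ) (`hasSum_geodesic`). The same vertex sum thus has one
expression for each pair; distributing it with the weights q_{ij} gives the theorem.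

The decay rests on growth. Along a geodesic the moving coordinates obey a linear recurrence and grow
exponentially, because a vanishing leading coefficient would push values of φ to 0. This handles the
finitely many geodesics with |φ| ≤ K; on the others |φ| > 2 suffices. A Kőnig argument shows that
distant edges point towards the root (`eventually_norm_le`). Then |φ| tends to infinity over the
geodesics (`eventually_geoWeight_le`), and the edges that continue a distant edge carry at most s <
1 times its weight (`eventually_sum_turnRatio_le`). -/

theorem exists_one_lt_norm_add_inv_eq {a : ℂ} (ha : ∀ t : ℝ, t ∈ Set.Icc (-2 : ℝ) 2 → a ≠ t) :
    ∃ z : ℂ, 1 < ‖z‖ ∧ z + z⁻¹ = a := by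
  obtain ⟨d, hd⟩ := IsAlgClosed.exists_pow_nat_eq (a ^ 2 - 4) (n := 2) (by norm_num)
  -- On the unit circle the inverse is the conjugate, so a = 2 Re z would lie in [-2, 2].
  have key : ∀ z : ℂ, z * (a - z) = 1 → ‖z‖ ≠ 1 := by
    intro z hz h1
    have hz0 : z ≠ 0 := by rintro rfl; simp at hz
    have hinv : z⁻¹ = (starRingEnd ℂ) z := by
      rw [Complex.inv_def, Complex.normSq_eq_norm_sq, h1]; simp
    have h2 : a - z = z⁻¹ := eq_inv_of_mul_eq_one_right hz
    have h3 : a = ((2 * z.re : ℝ) : ℂ) := by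
      have : a = z + (starRingEnd ℂ) z := by rw [← hinv, ← h2]; ring
      rw [this, Complex.add_conj]
    have h4 := abs_le.1 ((Complex.abs_re_le_norm z).trans h1.le)
    exact ha _ ⟨by linarith, by linarith⟩ h3
  set z := (a + d) / 2 with hzdef
  have hz : z * (a - z) = 1 := by
    have : z * (a - z) = (a ^ 2 - d ^ 2) / 4 := by rw [hzdef]; ring
    rw [this, hd]; ring
  have hz0 : z ≠ 0 := by intro h; rw [h] at hz; simp at hz
  have h2 : a - z = z⁻¹ := eq_inv_of_mul_eq_one_right hz
  rcases lt_or_gt_of_ne (key z hz) with h | h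
  · refine ⟨z⁻¹, ?_, ?_⟩
    · rw [norm_inv]; exact (one_lt_inv₀ (norm_pos_iff.2 hz0)).2 h
    · rw [inv_inv, ← h2]; ring
  · exact ⟨z, h, by rw [← h2]; ring⟩

/-- The leading coefficient `A` of the solution `A zᵐ + B z⁻ᵐ` with initial values `u`, `v`. -/
def leadCoeff (z u v : ℂ) : ℂ := (v - u * z⁻¹) / (z - z⁻¹)

theorem sub_inv_ne_zero {z : ℂ} (hz : 1 < ‖z‖) : z - z⁻¹ ≠ 0 := by
  intro h
  have h1 : ‖z‖ = ‖z‖⁻¹ := by rw [← norm_inv, ← sub_eq_zero.1 h]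
  have h2 := inv_lt_one_of_one_lt₀ hz
  linarith

section

variable {a z : ℂ} {y : ℕ → ℂ}

theorem recurrence_closed_form (hz : 1 < ‖z‖) (hza : z + z⁻¹ = a)
    (hy : ∀ m, y (m + 2) = a * y (m + 1) - y m) (m : ℕ) :
    y m = leadCoeff z (y 0) (y 1) * z ^ m + (z * y 0 - y 1) / (z - z⁻¹) * z⁻¹ ^ m := by
  have hz0 : z ≠ 0 := by rintro rfl; norm_num at hz
  have hd := sub_inv_ne_zero hz
  induction m using Nat.twoStepInduction with
  | zero =>
    unfold leadCoeff; rw [pow_zero, pow_zero, mul_one, mul_one, ← add_div, eq_div_iff hd]; ring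
  | one =>
    unfold leadCoeff
    rw [pow_one, pow_one, div_mul_eq_mul_div, div_mul_eq_mul_div, ← add_div, eq_div_iff hd]
    have := mul_inv_cancel₀ hz0
    ring
  | more m h1 h2 =>
    rw [hy, h1, h2, ← hza]
    have h := mul_inv_cancel₀ hz0
    have e1 : z ^ (m + 2) = (z + z⁻¹) * z ^ (m + 1) - z ^ m := by
      have : z ^ m * (z * z⁻¹) = z ^ m := by rw [h, mul_one]
      linear_combination -this
    have e2 : z⁻¹ ^ (m + 2) = (z + z⁻¹) * z⁻¹ ^ (m + 1) - z⁻¹ ^ m := by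
      have : z⁻¹ ^ m * (z * z⁻¹) = z⁻¹ ^ m := by rw [h, mul_one]
      linear_combination -this
    rw [e1, e2]; ring

/-- Exchanging u and v reverses the direction of travel. The product ties the growth in both
directions to the invariant u² + v² - a u v, which on a geodesic equals μ - σ. -/
theorem leadCoeff_mul_leadCoeff (hz : 1 < ‖z‖) (hza : z + z⁻¹ = a) (u v : ℂ) :
    leadCoeff z u v * leadCoeff z v u * (z - z⁻¹) ^ 2 * z = -(u ^ 2 + v ^ 2 - a * u * v) := by
  have hz0 : z ≠ 0 := by rintro rfl; norm_num at hz
  have hd := sub_inv_ne_zero hz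
  unfold leadCoeff
  have h := mul_inv_cancel₀ hz0
  have : (v - u * z⁻¹) / (z - z⁻¹) * ((u - v * z⁻¹) / (z - z⁻¹)) * (z - z⁻¹) ^ 2 * z
      = (v - u * z⁻¹) * (u - v * z⁻¹) * z := by
    rw [div_mul_div_comm, ← sq, div_mul_cancel₀ _ (pow_ne_zero 2 hd)]
  rw [this, ← hza]
  linear_combination (-(v^2) - u^2 + u * v * z⁻¹) * h

theorem tendsto_inv_pow_zero (hz : 1 < ‖z‖) : Tendsto (fun m : ℕ => z⁻¹ ^ m) atTop (𝓝 0) := by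
  apply tendsto_pow_atTop_nhds_zero_of_norm_lt_one
  rw [norm_inv]; exact inv_lt_one_of_one_lt₀ hz

theorem tendsto_mul_inv_pow (hz : 1 < ‖z‖) (hza : z + z⁻¹ = a)
    (hy : ∀ m, y (m + 2) = a * y (m + 1) - y m) :
    Tendsto (fun m => y m * z⁻¹ ^ m) atTop (𝓝 (leadCoeff z (y 0) (y 1))) := by
  have hz0 : z ≠ 0 := by rintro rfl; norm_num at hz
  have h0 := tendsto_inv_pow_zero hz
  have : (fun m => y m * z⁻¹ ^ m) = fun m => leadCoeff z (y 0) (y 1)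
      + (z * y 0 - y 1) / (z - z⁻¹) * (z⁻¹ ^ m * z⁻¹ ^ m) := by
    funext m
    rw [recurrence_closed_form hz hza hy m, add_mul, mul_assoc _ (z ^ m), ← mul_pow,
      mul_inv_cancel₀ hz0, one_pow]
    ring
  rw [this]
  simpa using tendsto_const_nhds.add ((h0.mul h0).const_mul ((z * y 0 - y 1) / (z - z⁻¹)))

theorem tendsto_zero_of_leadCoeff_eq_zero (hz : 1 < ‖z‖) (hza : z + z⁻¹ = a)
    (hy : ∀ m, y (m + 2) = a * y (m + 1) - y m) (h : leadCoeff z (y 0) (y 1) = 0) :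
    Tendsto y atTop (𝓝 0) := by
  have : y = fun m => (z * y 0 - y 1) / (z - z⁻¹) * z⁻¹ ^ m := by
    funext m
    conv_lhs => rw [recurrence_closed_form hz hza hy m, h]
    ring
  rw [this]
  simpa using (tendsto_inv_pow_zero hz).const_mul ((z * y 0 - y 1) / (z - z⁻¹))

theorem tendsto_norm_atTop_of_leadCoeff_ne_zero (hz : 1 < ‖z‖) (hza : z + z⁻¹ = a)
    (hy : ∀ m, y (m + 2) = a * y (m + 1) - y m) (h : leadCoeff z (y 0) (y 1) ≠ 0) :
    Tendsto (fun m => ‖y m‖) atTop atTop := by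
  have hz0 : z ≠ 0 := by rintro rfl; norm_num at hz
  have h1 := (tendsto_mul_inv_pow hz hza hy).norm
  have h2 := (tendsto_pow_atTop_atTop_of_one_lt hz).atTop_mul_pos (norm_pos_iff.2 h) h1
  refine h2.congr fun m => ?_
  rw [norm_mul, norm_pow, norm_inv]
  have : ‖z‖ ^ m ≠ 0 := pow_ne_zero _ (norm_ne_zero_iff.2 hz0)
  rw [inv_pow]; field_simp

/-- The ratio of the squares tends to |z|⁻²; the weaker factor |z|⁻¹ leaves room for an inequality
at finite m. -/
theorem eventually_norm_sq_le (hz : 1 < ‖z‖) (hza : z + z⁻¹ = a)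
    (hy : ∀ m, y (m + 2) = a * y (m + 1) - y m) (h : leadCoeff z (y 0) (y 1) ≠ 0) :
    ∀ᶠ m in atTop, ‖y m‖ ^ 2 ≤ ‖z‖⁻¹ * ‖y (m + 1)‖ ^ 2 := by
  have hz0 : z ≠ 0 := by rintro rfl; norm_num at hz
  have h1 := (tendsto_mul_inv_pow hz hza hy).norm.pow 2
  have hA : 0 < ‖leadCoeff z (y 0) (y 1)‖ ^ 2 := by positivity
  have h2 := (h1.comp (tendsto_add_atTop_nat 1)).const_mul ‖z‖
  have hlt : ‖leadCoeff z (y 0) (y 1)‖ ^ 2 < ‖z‖ * ‖leadCoeff z (y 0) (y 1)‖ ^ 2 := by nlinarith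
  filter_upwards [h1.eventually_lt h2 hlt] with m hm
  have hp : 0 < ‖z‖ := norm_pos_iff.2 hz0
  simp only [Function.comp, norm_mul, norm_pow, norm_inv, mul_pow] at hm
  have hq : 0 < (‖z‖⁻¹ ^ m) ^ 2 := by positivity
  have e : ‖z‖ * (‖y (m + 1)‖ ^ 2 * (‖z‖⁻¹ ^ (m + 1)) ^ 2)
      = (‖z‖⁻¹ * ‖y (m + 1)‖ ^ 2) * (‖z‖⁻¹ ^ m) ^ 2 := by
    rw [pow_succ]
    linear_combination (‖z‖⁻¹ * ‖y (m + 1)‖ ^ 2 * (‖z‖⁻¹ ^ m) ^ 2) * mul_inv_cancel₀ hp.ne'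
  rw [e] at hm
  exact (lt_of_mul_lt_mul_right hm hq.le).le

/-- Telescoping: up to the constant A (z - z⁻¹), each term is the difference of z⁻ᵐ / y m at m and m
+ 1, and this quantity tends to 0. -/
theorem hasSum_inv_mul_succ (hz : 1 < ‖z‖) (hza : z + z⁻¹ = a)
    (hy : ∀ m, y (m + 2) = a * y (m + 1) - y m) (h : leadCoeff z (y 0) (y 1) ≠ 0)
    (hne : ∀ m, y m ≠ 0) (hs : Summable fun m => (y m * y (m + 1))⁻¹) :
    HasSum (fun m => (y m * y (m + 1))⁻¹)
      (y 0 * leadCoeff z (y 0) (y 1) * (z - z⁻¹))⁻¹ := by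
  have hz0 : z ≠ 0 := by rintro rfl; norm_num at hz
  have hd := sub_inv_ne_zero hz
  set A := leadCoeff z (y 0) (y 1) with hA
  rw [hs.hasSum_iff_tendsto_nat]
  have e : ∀ m, y m * z⁻¹ - y (m + 1) = - A * (z - z⁻¹) * z ^ m := by
    intro m
    rw [recurrence_closed_form hz hza hy m, recurrence_closed_form hz hza hy (m + 1), ← hA]
    have := mul_inv_cancel₀ hz0
    ring
  have e2 : ∀ M, ∑ m ∈ Finset.range M, (y m * y (m + 1))⁻¹
      = ((y 0)⁻¹ - z⁻¹ ^ M * (y M)⁻¹) * (A * (z - z⁻¹))⁻¹ := by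
    intro M
    induction M with
    | zero => simp
    | succ M ih =>
      rw [Finset.sum_range_succ, ih, ← sub_eq_zero]
      have h1 := hne M
      have h2 := hne (M + 1)
      have h3 := e M
      have h4 : z⁻¹ ^ M * z ^ M = 1 := by rw [← mul_pow, inv_mul_cancel₀ hz0, one_pow]
      have h5 : (y M * y (M + 1))⁻¹ * (A * (z - z⁻¹)) = z⁻¹ ^ M * (y M)⁻¹
          - z⁻¹ ^ (M + 1) * (y (M + 1))⁻¹ := by
        rw [pow_succ, inv_mul_eq_iff_eq_mul₀ (mul_ne_zero h1 h2)]
        have : y M * y (M + 1) * (z⁻¹ ^ M * (y M)⁻¹ - z⁻¹ ^ M * z⁻¹ * (y (M + 1))⁻¹)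
          = z⁻¹ ^ M * (y (M + 1) * (y M * (y M)⁻¹) - y M * z⁻¹ * (y (M + 1) * (y (M + 1))⁻¹)) := by
          ring
        rw [this, mul_inv_cancel₀ h1, mul_inv_cancel₀ h2]
        linear_combination (z⁻¹ ^ M) * h3 - A * (z - z⁻¹) * h4
      have hn : A * (z - z⁻¹) ≠ 0 := mul_ne_zero h hd
      rw [← eq_div_iff hn] at h5
      rw [h5]; field_simp; ring
  simp_rw [e2]
  have ht : Tendsto (fun M => z⁻¹ ^ M * (y M)⁻¹) atTop (𝓝 0) := by
    have h1 := (tendsto_mul_inv_pow hz hza hy).inv₀ h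
    have h2 := (tendsto_inv_pow_zero hz).mul (tendsto_inv_pow_zero hz)
    have h3 := h2.mul h1
    simp only [mul_zero, zero_mul] at h3
    refine h3.congr fun m => ?_
    have : z⁻¹ ^ m ≠ 0 := pow_ne_zero _ (inv_ne_zero hz0)
    rw [mul_inv]; field_simp
  have := (tendsto_const_nhds (x := (y 0)⁻¹)).sub ht |>.mul_const (A * (z - z⁻¹))⁻¹
  rw [sub_zero, ← mul_inv, ← mul_assoc] at this
  exact this

end

variable {n : ℕ}

/-! ### Reduced words -/

/-- A reduced word in the colours: no two adjacent letters agree. -/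
abbrev Red (l : List (Fin n)) : Prop := l.IsChain (· ≠ ·)

theorem Red.tail {i : Fin n} {l : List (Fin n)} (h : Red (i :: l)) : Red l := List.IsChain.tail h

theorem red_cons_cons {i j : Fin n} {l : List (Fin n)} :
    Red (j :: i :: l) ↔ j ≠ i ∧ Red (i :: l) := List.isChain_cons_cons

/-- The filter of words whose length tends to infinity. -/
def lenTop (n : ℕ) : Filter (List (Fin n)) := comap List.length atTop

theorem eventually_lenTop {P : List (Fin n) → Prop} :
    (∀ᶠ l in lenTop n, P l) ↔ ∃ R, ∀ l : List (Fin n), R ≤ l.length → P l := by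
  unfold lenTop
  rw [eventually_comap, eventually_atTop]
  exact ⟨fun ⟨R, h⟩ => ⟨R, fun l hl => h _ hl _ rfl⟩, fun ⟨R, h⟩ => ⟨R, fun b hb l hl => h l (hl ▸ hb)⟩⟩

/-- Strip the longest initial segment with letters in `I`. -/
def strip (I : Finset (Fin n)) (l : List (Fin n)) : List (Fin n) :=
  l.dropWhile (fun k => decide (k ∈ I))

theorem strip_nil (I : Finset (Fin n)) : strip I [] = [] := rfl

theorem strip_cons_of_mem {I : Finset (Fin n)} {i : Fin n} (h : i ∈ I) (l : List (Fin n)) :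
    strip I (i :: l) = strip I l := by
  simp [strip, h]

theorem strip_cons_of_notMem {I : Finset (Fin n)} {i : Fin n} (h : i ∉ I) (l : List (Fin n)) :
    strip I (i :: l) = i :: l := by
  simp [strip, h]

/-- Stripping a word leads to the vertex of its `I`-regular subtree closest to the root: there, all
edges with colour in `I` lead away from the root. -/
theorem red_cons_strip {I : Finset (Fin n)} {i : Fin n} (hi : i ∈ I) {l : List (Fin n)}
    (h : Red l) : Red (i :: strip I l) := by
  induction l with
  | nil => simp [strip_nil]
  | cons k l ih =>
    by_cases hk : k ∈ I
    · rw [strip_cons_of_mem hk]; exact ih h.tail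
    · rw [strip_cons_of_notMem hk]
      exact red_cons_cons.2 ⟨by rintro rfl; exact hk hi, h⟩

theorem strip_eq_self {I : Finset (Fin n)} {l : List (Fin n)} (h : ∀ i ∈ I, Red (i :: l)) :
    strip I l = l := by
  cases l with
  | nil => rfl
  | cons k l =>
    apply strip_cons_of_notMem
    intro hk
    exact (red_cons_cons.1 (h k hk)).1 rfl

/-- The letter with index `m` of the alternating word in `i`, `j`. -/
def altCol (i j : Fin n) (m : ℕ) : Fin n := if Even m then i else j

theorem altCol_zero (i j : Fin n) : altCol i j 0 = i := by simp [altCol]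

theorem altCol_one (i j : Fin n) : altCol i j 1 = j := by simp [altCol]

theorem altCol_add_two (i j : Fin n) (m : ℕ) : altCol i j (m + 2) = altCol i j m := by
  simp [altCol, Nat.even_add]

theorem altCol_succ_ne {i j : Fin n} (h : i ≠ j) (m : ℕ) : altCol i j (m + 1) ≠ altCol i j m := by
  by_cases hm : Even m
  · simp [altCol, Nat.even_add_one, hm, h.symm]
  · simp [altCol, Nat.even_add_one, hm, h]

theorem altCol_cases (i j : Fin n) (m : ℕ) :
    (altCol i j m = i ∧ altCol i j (m + 1) = j) ∨ (altCol i j m = j ∧ altCol i j (m + 1) = i) := by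
  by_cases hm : Even m
  · simp [altCol, Nat.even_add_one, hm]
  · simp [altCol, Nat.even_add_one, hm]

/-- The word `b` preceded by the alternating word of length `m` in `i`, `j`. -/
def alt (i j : Fin n) (b : List (Fin n)) : ℕ → List (Fin n)
  | 0 => b
  | m + 1 => altCol i j m :: alt i j b m

theorem alt_zero (i j : Fin n) (b : List (Fin n)) : alt i j b 0 = b := rfl

theorem alt_succ (i j : Fin n) (b : List (Fin n)) (m : ℕ) :
    alt i j b (m + 1) = altCol i j m :: alt i j b m := rfl

theorem length_alt (i j : Fin n) (b : List (Fin n)) (m : ℕ) :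
    (alt i j b m).length = b.length + m := by
  induction m with
  | zero => rfl
  | succ m ih => rw [alt_succ, List.length_cons, ih]; rfl

theorem red_cons_alt {i j : Fin n} (h : i ≠ j) {b : List (Fin n)} (hi : Red (i :: b)) (m : ℕ) :
    Red (altCol i j m :: alt i j b m) := by
  induction m with
  | zero => simpa [altCol_zero, alt_zero] using hi
  | succ m ih => exact red_cons_cons.2 ⟨altCol_succ_ne h m, ih⟩

theorem red_alt {i j : Fin n} (h : i ≠ j) {b : List (Fin n)} (hi : Red (i :: b)) (m : ℕ) :
    Red (alt i j b m) := (red_cons_alt h hi m).tail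

theorem strip_alt {i j : Fin n} {b : List (Fin n)} (hi : Red (i :: b)) (hj : Red (j :: b)) (m : ℕ) :
    strip {i, j} (alt i j b m) = b := by
  induction m with
  | zero => exact strip_eq_self (by simp [alt_zero, hi, hj])
  | succ m ih =>
    rw [alt_succ, strip_cons_of_mem, ih]
    rcases altCol_cases i j m with h | h <;> simp [h.1]

theorem exists_eq_alt {i j : Fin n} (hij : i ≠ j) {b l : List (Fin n)} (h : Red l)
    (hb : strip {i, j} l = b) : ∃ m, l = alt i j b m ∨ l = alt j i b m := by
  induction l with
  | nil => exact ⟨0, Or.inl (by rw [← hb]; rfl)⟩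
  | cons k l ih =>
    by_cases hk : k ∈ ({i, j} : Finset (Fin n))
    · rw [strip_cons_of_mem hk] at hb
      obtain ⟨m, hm⟩ := ih h.tail hb
      have aux : ∀ i j : Fin n, i ≠ j → k ∈ ({i, j} : Finset (Fin n)) → l = alt i j b m →
          ∃ m, k :: l = alt i j b m ∨ k :: l = alt j i b m := by
        rintro i j hij hk rfl
        cases m with
        | zero =>
          refine ⟨1, ?_⟩
          rcases Finset.mem_insert.1 hk with rfl | hk
          · left; simp [alt, altCol_zero]
          · rw [Finset.mem_singleton] at hk; subst hk
            right; simp [alt, altCol_zero]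
        | succ m =>
          refine ⟨m + 2, Or.inl ?_⟩
          have h1 := (red_cons_cons.1 h).1
          rw [alt_succ _ _ _ (m + 1)]
          congr 1
          simp only [Finset.mem_insert, Finset.mem_singleton] at hk
          rcases altCol_cases i j m with h | h <;> rw [h.1] at h1 <;> rw [h.2] <;> tauto
      rcases hm with hm | hm
      · exact aux i j hij hk hm
      · obtain ⟨m, hm⟩ := aux j i hij.symm (by rwa [Finset.pair_comm]) hm
        exact ⟨m, hm.symm⟩
    · exact ⟨0, Or.inl (by rw [← hb, strip_cons_of_notMem hk]; rfl)⟩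

/-! ### Hurwitz systems on words -/

/-- The product of the coordinates with colours other than `i`, `j`. -/
def pairProd (X : List (Fin n) → Fin n → ℂ) (l : List (Fin n)) (i j : Fin n) : ℂ :=
  ∏ k ∈ ({i, j} : Finset (Fin n))ᶜ, X l k

/-- The sum of the squares of the coordinates with colours other than `i`, `j`. -/
def pairSq (X : List (Fin n) → Fin n → ℂ) (l : List (Fin n)) (i j : Fin n) : ℂ :=
  ∑ k ∈ ({i, j} : Finset (Fin n))ᶜ, X l k ^ 2

/-- The product of the coordinates with colours other than `i`. -/
def coProd (X : List (Fin n) → Fin n → ℂ) (l : List (Fin n)) (i : Fin n) : ℂ :=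
  ∏ k ∈ ({i} : Finset (Fin n))ᶜ, X l k

/-- A `μ`-Hurwitz map that satisfies the Bowditch conditions, in terms of its coordinates at the
vertices; the vertex with word `i :: l` is the neighbour of `l` along the edge of colour `i`. -/
structure BowditchSystem (n : ℕ) (μ : ℂ) (X : List (Fin n) → Fin n → ℂ) : Prop where
  three_le : 3 ≤ n
  of_ne : ∀ l i k, k ≠ i → X (i :: l) k = X l k
  edge : ∀ l i, X l i + X (i :: l) i = coProd X l i
  vertex : ∀ l, ∑ k, X l k ^ 2 - ∏ k, X l k = μ
  pair_ne : ∀ l i j, i ≠ j → ∀ t : ℝ, t ∈ Set.Icc (-2 : ℝ) 2 → pairProd X l i j ≠ t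
  -- The two reducedness conditions single out the vertex of the geodesic closest to the root, so
  -- each geodesic is tested once and (B2) becomes a statement about long words.
  exists_bound : ∃ K : ℝ, 2 < K ∧ ∀ᶠ l in lenTop n, ∀ i j, i ≠ j → Red (i :: l) → Red (j :: l) →
    K < ‖pairProd X l i j‖

theorem pairProd_comm (X : List (Fin n) → Fin n → ℂ) (l : List (Fin n)) (i j : Fin n) :
    pairProd X l i j = pairProd X l j i := by
  unfold pairProd; rw [Finset.pair_comm]

theorem coProd_eq_mul_pairProd (X : List (Fin n) → Fin n → ℂ) (l : List (Fin n)) {i j : Fin n}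
    (h : i ≠ j) : coProd X l i = X l j * pairProd X l i j := by
  unfold coProd pairProd
  have : ({i} : Finset (Fin n))ᶜ = insert j ({i, j} : Finset (Fin n))ᶜ := by
    ext k; simp only [Finset.mem_compl, Finset.mem_insert, Finset.mem_singleton]
    by_cases hk : k = j
    · subst hk; simp [h.symm]
    · simp [hk]
  rw [this, Finset.prod_insert (by simp)]

theorem prod_eq_mul_coProd (X : List (Fin n) → Fin n → ℂ) (l : List (Fin n)) (i : Fin n) :
    ∏ k, X l k = X l i * coProd X l i := by
  unfold coProd
  rw [Fintype.prod_eq_mul_prod_compl]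

theorem exists_ne_ne (hn : 3 ≤ n) (i j : Fin n) : ∃ k, k ≠ i ∧ k ≠ j := by
  have : ({i, j} : Finset (Fin n))ᶜ.Nonempty := by
    rw [← Finset.card_pos, Finset.card_compl, Fintype.card_fin]
    have := Finset.card_le_two (a := i) (b := j)
    omega
  obtain ⟨k, hk⟩ := this
  simp only [Finset.mem_compl, Finset.mem_insert, Finset.mem_singleton, not_or] at hk
  exact ⟨k, hk⟩

namespace BowditchSystem

variable {μ : ℂ} {X : List (Fin n) → Fin n → ℂ} (S : BowditchSystem n μ X)

include S

theorem pairProd_ne_zero {i j : Fin n} (h : i ≠ j) (l : List (Fin n)) : pairProd X l i j ≠ 0 := by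
  have := S.pair_ne l i j h 0 (by norm_num)
  simpa using this

theorem ne_zero (l : List (Fin n)) (k : Fin n) : X l k ≠ 0 := by
  obtain ⟨i, hi, -⟩ := exists_ne_ne S.three_le k k
  obtain ⟨j, hj, hji⟩ := exists_ne_ne S.three_le k i
  intro h
  apply S.pairProd_ne_zero hji l
  unfold pairProd
  exact Finset.prod_eq_zero (by simp [hi.symm, hj.symm]) h

theorem coProd_ne_zero (l : List (Fin n)) (k : Fin n) : coProd X l k ≠ 0 :=
  Finset.prod_ne_zero_iff.2 fun i _ => S.ne_zero l i

theorem apply_strip {I : Finset (Fin n)} {k : Fin n} (hk : k ∉ I) (l : List (Fin n)) :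
    X (strip I l) k = X l k := by
  induction l with
  | nil => rfl
  | cons i l ih =>
    by_cases hi : i ∈ I
    · rw [strip_cons_of_mem hi, ih, S.of_ne]
      rintro rfl; exact hk hi
    · rw [strip_cons_of_notMem hi]

theorem pairProd_strip (i j : Fin n) (l : List (Fin n)) :
    pairProd X (strip {i, j} l) i j = pairProd X l i j :=
  Finset.prod_congr rfl fun _ hk => S.apply_strip (Finset.mem_compl.1 hk) l

theorem pairSq_strip (i j : Fin n) (l : List (Fin n)) :
    pairSq X (strip {i, j} l) i j = pairSq X l i j :=
  Finset.sum_congr rfl fun k hk => by rw [S.apply_strip (Finset.mem_compl.1 hk) l]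

theorem pairProd_cons (i j : Fin n) (l : List (Fin n)) :
    pairProd X (i :: l) i j = pairProd X l i j :=
  Finset.prod_congr rfl fun k hk => S.of_ne _ _ _ (by
    simp only [Finset.mem_compl, Finset.mem_insert, Finset.mem_singleton, not_or] at hk
    exact hk.1)

theorem coProd_cons (i : Fin n) (l : List (Fin n)) :
    coProd X (i :: l) i = coProd X l i :=
  Finset.prod_congr rfl fun k hk => S.of_ne _ _ _ (by simpa using hk)

/-- Beyond some level the base vertices give |φ(γ)| > K > 2; below it only finitely many nonzero
values remain. -/
theorem exists_le_norm_pairProd :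
    ∃ ε > 0, ∀ l i j, Red l → i ≠ j → ε ≤ ‖pairProd X l i j‖ := by
  obtain ⟨K, hK, h⟩ := S.exists_bound
  obtain ⟨R, hR⟩ := eventually_lenTop.1 h
  have h1 : ∀ᶠ ε in 𝓝[>] (0 : ℝ), ∀ l ∈ {l : List (Fin n) | l.length < R}, ∀ i j, i ≠ j →
      ε ≤ ‖pairProd X l i j‖ := by
    rw [eventually_all_finite (List.finite_length_lt _ _)]
    intro l _
    rw [eventually_all]; intro i
    rw [eventually_all]; intro j
    by_cases hij : i = j
    · exact Eventually.of_forall fun _ h => absurd hij h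
    · have := norm_pos_iff.2 (S.pairProd_ne_zero hij l)
      filter_upwards [Ioo_mem_nhdsGT this] with ε hε _ using hε.2.le
  have h2 : ∀ᶠ ε in 𝓝[>] (0 : ℝ), ε ∈ Set.Ioo (0 : ℝ) 2 := Ioo_mem_nhdsGT (by norm_num)
  obtain ⟨ε, hε, h0, hε2⟩ := (h1.and h2).exists
  refine ⟨ε, h0, fun l i j hl hij => ?_⟩
  rw [← S.pairProd_strip]
  by_cases hb : R ≤ (strip {i, j} l).length
  · have := hR _ hb i j hij (red_cons_strip (by simp) hl) (red_cons_strip (by simp) hl)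
    linarith
  · exact hε _ (not_le.1 hb) i j hij

/-- The moving coordinates along a geodesic. -/
theorem apply_alt_succ {i j : Fin n} (h : i ≠ j) (b : List (Fin n)) (m : ℕ) :
    X (alt i j b m) (altCol i j (m + 1)) = X (alt i j b (m + 1)) (altCol i j (m + 1)) := by
  rw [alt_succ, S.of_ne _ _ _ (altCol_succ_ne h m)]

theorem pairProd_alt (i j : Fin n) (b : List (Fin n)) (m : ℕ) :
    pairProd X (alt i j b m) i j = pairProd X b i j := by
  induction m with
  | zero => rfl
  | succ m ih =>
    rw [alt_succ, ← ih]
    rcases altCol_cases i j m with h | h <;> rw [h.1]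
    · exact S.pairProd_cons _ _ _
    · rw [pairProd_comm, S.pairProd_cons, pairProd_comm]

/-- The moving coordinates at step m are y m and y (m + 1). Crossing the next edge replaces y m by y
(m + 2), and the edge relation factors through φ(γ), which is constant along the geodesic. -/
theorem alt_recurrence {i j : Fin n} (h : i ≠ j) (b : List (Fin n)) (m : ℕ) :
    X (alt i j b (m + 2)) (altCol i j (m + 2)) =
      pairProd X b i j * X (alt i j b (m + 1)) (altCol i j (m + 1))
        - X (alt i j b m) (altCol i j m) := by
  have h1 := S.apply_alt_succ h b (m + 1)
  rw [← h1, altCol_add_two, eq_sub_iff_add_eq', alt_succ, S.edge,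
    coProd_eq_mul_pairProd X _ (altCol_succ_ne h m).symm, ← alt_succ, ← S.apply_alt_succ h,
    ← S.pairProd_alt i j b m, mul_comm]
  congr 1
  rcases altCol_cases i j m with h | h <;> rw [h.1, h.2]
  rw [pairProd_comm]

theorem vertex_pair {i j : Fin n} (h : i ≠ j) (l : List (Fin n)) :
    X l i ^ 2 + X l j ^ 2 - pairProd X l i j * X l i * X l j = μ - pairSq X l i j := by
  have h1 := S.vertex l
  rw [prod_eq_mul_coProd X l i, coProd_eq_mul_pairProd X l h,
    ← Finset.sum_add_sum_compl ({i, j} : Finset (Fin n)), Finset.sum_pair h] at h1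
  unfold pairSq
  linear_combination h1

/-- The weight `σ` of a geodesic is never `μ`. -/
theorem pairSq_ne {i j : Fin n} (hij : i ≠ j) {l : List (Fin n)} (hl : Red l) :
    pairSq X l i j ≠ μ := by
  -- A vanishing leading coefficient would send the moving coordinates to 0 along the ray.
  have main : ∀ i j : Fin n, i ≠ j → ∀ b : List (Fin n), Red (i :: b) →
      ∀ z : ℂ, 1 < ‖z‖ → z + z⁻¹ = pairProd X b i j → leadCoeff z (X b i) (X b j) ≠ 0 := by
    intro i j hij b hi z hz hza h0
    have h1 := tendsto_zero_of_leadCoeff_eq_zero (y := fun m => X (alt i j b m) (altCol i j m))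
      hz hza (S.alt_recurrence hij b)
      (by
        rw [← h0, ← zero_add 1, ← S.apply_alt_succ hij, zero_add, alt_zero, altCol_zero,
          altCol_one])
    obtain ⟨k, hki, hkj⟩ := exists_ne_ne S.three_le i j
    obtain ⟨ε, hε, hlow⟩ := S.exists_le_norm_pairProd
    -- Two factorisations of one product: φ(γ) y (m + 1) = x_k φ(γ'), where γ' takes the edge about
    -- to be crossed and the fixed colour k. Since |φ(γ')| ≥ ε and x_k is constant, y stays away
    -- from 0.
    have h2 : ∀ m, ‖X b k‖ * ε
        ≤ ‖pairProd X b i j‖ * ‖X (alt i j b (m + 1)) (altCol i j (m + 1))‖ := by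
      intro m
      have e : X (alt i j b m) k = X b k := by
        rw [← S.apply_strip (I := {i, j}) (by simp [hki, hkj])]
        induction m with
        | zero => rw [alt_zero, S.apply_strip (by simp [hki, hkj])]
        | succ m ih =>
          rw [alt_succ, strip_cons_of_mem, ih]
          rcases altCol_cases i j m with h | h <;> simp [h.1]
      have hk : altCol i j m ≠ k := by
        rcases altCol_cases i j m with h | h <;> rw [h.1]
        · exact hki.symm
        · exact hkj.symm
      have h3 := coProd_eq_mul_pairProd X (alt i j b m) (altCol_succ_ne hij m).symm
      rw [coProd_eq_mul_pairProd X (alt i j b m) hk, e, S.apply_alt_succ hij] at h3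
      have h4 : pairProd X (alt i j b m) (altCol i j m) (altCol i j (m + 1)) = pairProd X b i j := by
        rw [← S.pairProd_alt i j b m]
        rcases altCol_cases i j m with h | h <;> rw [h.1, h.2]
        rw [pairProd_comm]
      rw [h4] at h3
      rw [mul_comm ‖pairProd X b i j‖, ← norm_mul, ← h3, norm_mul]
      exact mul_le_mul_of_nonneg_left (hlow _ _ _ (red_alt hij hi m) hk) (norm_nonneg _)
    have h3 := ((h1.comp (tendsto_add_atTop_nat 1)).norm).const_mul ‖pairProd X b i j‖
    rw [norm_zero, mul_zero] at h3
    have h4 := ge_of_tendsto' h3 h2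
    have h5 : 0 < ‖X b k‖ * ε := mul_pos (norm_pos_iff.2 (S.ne_zero b k)) hε
    linarith
  intro h
  rw [← S.pairSq_strip] at h
  have hi := red_cons_strip (I := {i, j}) (i := i) (by simp) hl
  have hj := red_cons_strip (I := {i, j}) (i := j) (by simp) hl
  generalize strip {i, j} l = b at h hi hj
  obtain ⟨z, hz, hza⟩ := exists_one_lt_norm_add_inv_eq (S.pair_ne b i j hij)
  have h1 := leadCoeff_mul_leadCoeff hz hza (X b i) (X b j)
  rw [S.vertex_pair hij, h, sub_self, neg_zero] at h1
  have hz0 : z ≠ 0 := by rintro rfl; norm_num at hz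
  have hne := mul_ne_zero (mul_ne_zero (mul_ne_zero (main i j hij b hi z hz hza)
    (main j i hij.symm b hj z hz (by rw [hza, pairProd_comm])))
    (pow_ne_zero 2 (sub_inv_ne_zero hz))) hz0
  exact hne h1

theorem leadCoeff_ne_zero {i j : Fin n} (hij : i ≠ j) {l : List (Fin n)} (hl : Red l) {z : ℂ}
    (hz : 1 < ‖z‖) (hza : z + z⁻¹ = pairProd X l i j) : leadCoeff z (X l i) (X l j) ≠ 0 := by
  intro h
  have h1 := leadCoeff_mul_leadCoeff hz hza (X l i) (X l j)
  rw [S.vertex_pair hij, h] at h1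
  apply S.pairSq_ne hij hl
  linear_combination -h1

/-- Growth along one geodesic. -/
theorem growth_on_geodesic {i j : Fin n} (hij : i ≠ j) {b : List (Fin n)} (hb : Red b) :
    ∃ s < (1 : ℝ), ∀ ε > 0, ∀ᶠ l in lenTop n, Red (i :: l) → strip {i, j} l = b →
      ‖X l j‖ ^ 2 ≤ s * ‖X (i :: l) i‖ ^ 2 ∧ ‖X l i‖ < ‖X (i :: l) i‖ ∧
        ∀ k, k ≠ i → k ≠ j → ‖X l k‖ ≤ ε * ‖X (i :: l) i‖ := by
  obtain ⟨z, hz, hza⟩ := exists_one_lt_norm_add_inv_eq (S.pair_ne b i j hij)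
  have hs1 : ‖z‖⁻¹ < 1 := inv_lt_one_of_one_lt₀ hz
  refine ⟨‖z‖⁻¹, hs1, fun ε hε => ?_⟩
  have key : ∀ p q : Fin n, p ≠ q → z + z⁻¹ = pairProd X b p q →
      ∀ᶠ m in atTop, ∀ y : ℕ → ℂ, (y = fun m => X (alt p q b m) (altCol p q m)) →
        ‖y (m + 1)‖ ^ 2 ≤ ‖z‖⁻¹ * ‖y (m + 2)‖ ^ 2 ∧ ‖y m‖ < ‖y (m + 2)‖ ∧
        ∀ k, ‖X b k‖ ≤ ε * ‖y (m + 2)‖ := by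
    intro p q hpq hpz
    have hy0 : leadCoeff z (X (alt p q b 0) (altCol p q 0)) (X (alt p q b 1) (altCol p q 1)) ≠ 0 := by
      rw [← zero_add 1, ← S.apply_alt_succ hpq, zero_add, alt_zero, altCol_zero, altCol_one]
      exact S.leadCoeff_ne_zero hpq hb hz hpz
    have g1 := eventually_norm_sq_le (y := fun m => X (alt p q b m) (altCol p q m)) hz hpz
      (S.alt_recurrence hpq b) hy0
    have g2 := tendsto_norm_atTop_of_leadCoeff_ne_zero
      (y := fun m => X (alt p q b m) (altCol p q m)) hz hpz
      (S.alt_recurrence hpq b) hy0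
    -- The remaining coordinates are constant along the geodesic, while the moving ones tend to
    -- infinity.
    have g3 : ∀ᶠ m in atTop, ∀ k, ‖X b k‖ ≤ ε * ‖X (alt p q b m) (altCol p q m)‖ := by
      rw [eventually_all]; intro k
      filter_upwards [g2.eventually_ge_atTop (‖X b k‖ / ε)] with m hm
      rw [div_le_iff₀ hε] at hm; linarith
    have t1 := tendsto_add_atTop_nat 1
    have t2 := tendsto_add_atTop_nat 2
    filter_upwards [g1, t1.eventually g1, t2.eventually g3] with m h1 h2 h3
    rintro y rfl
    refine ⟨h2, ?_, h3⟩
    have hpos : 0 < ‖X (alt p q b (m + 2)) (altCol p q (m + 2))‖ ^ 2 := by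
      rcases altCol_cases p q (m + 2) with h | h <;> rw [h.1] <;>
        exact pow_pos (norm_pos_iff.2 (S.ne_zero _ _)) 2
    have hinv : 0 ≤ ‖z‖⁻¹ := by positivity
    refine lt_of_pow_lt_pow_left₀ 2 (norm_nonneg _) ?_
    nlinarith [mul_le_mul_of_nonneg_left h2 hinv, mul_pos (sub_pos.2 hs1) hpos]
  obtain ⟨M, hM⟩ := eventually_atTop.1 ((key i j hij hza).and
    (key j i hij.symm (by rw [hza, pairProd_comm])))
  rw [eventually_lenTop]
  refine ⟨b.length + (M + 1), fun l hl hred hst => ?_⟩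
  have main : ∀ p q : Fin n, p ≠ q → ((p = i ∧ q = j) ∨ (p = j ∧ q = i)) → ∀ m, l = alt p q b (m + 1) →
      (∀ y : ℕ → ℂ, (y = fun m => X (alt p q b m) (altCol p q m)) →
        ‖y (m + 2)‖ ^ 2 ≤ ‖z‖⁻¹ * ‖y (m + 3)‖ ^ 2 ∧ ‖y (m + 1)‖ < ‖y (m + 3)‖ ∧
        ∀ k, ‖X b k‖ ≤ ε * ‖y (m + 3)‖) →
      ‖X l j‖ ^ 2 ≤ ‖z‖⁻¹ * ‖X (i :: l) i‖ ^ 2 ∧ ‖X l i‖ < ‖X (i :: l) i‖ ∧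
        ∀ k, k ≠ i → k ≠ j → ‖X l k‖ ≤ ε * ‖X (i :: l) i‖ := by
    intro p q hpq hor m hlm hh
    -- Reducedness excludes turning back, so the letter i must continue the alternation.
    have hne : i ≠ altCol p q m := by
      rw [hlm, alt_succ] at hred; exact (red_cons_cons.1 hred).1
    have hc : altCol p q (m + 1) = i ∧ altCol p q (m + 2) = j := by
      rw [altCol_add_two]
      rcases hor with ⟨rfl, rfl⟩ | ⟨rfl, rfl⟩ <;> rcases altCol_cases p q m with h | h <;>
        rw [h.1] at hne <;> rw [h.1, h.2] <;> tauto
    have e1 : i :: l = alt p q b (m + 2) := by rw [alt_succ, hc.1, hlm]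
    have e2 : altCol p q (m + 3) = i := by rw [altCol_add_two, hc.1]
    obtain ⟨a1, a2, a3⟩ := hh _ rfl
    have a4 := S.apply_alt_succ hpq b (m + 1)
    have a5 := S.apply_alt_succ hpq b (m + 2)
    rw [hc.2, ← hlm] at a4
    rw [e2, ← e1] at a5
    simp only [hc.1, e2, ← a5, ← hlm, hc.2, ← a4] at a1 a2 a3
    refine ⟨a1, a2, fun k hki hkj => ?_⟩
    rw [← S.apply_strip (I := {i, j}) (by simp [hki, hkj]) l, hst]
    exact a3 k
  obtain ⟨m, hm⟩ := exists_eq_alt hij hred.tail hst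
  have hlen : M + 1 ≤ m := by
    have := length_alt i j b m
    have := length_alt j i b m
    rcases hm with hm | hm <;> rw [hm] at hl <;> omega
  obtain ⟨m, rfl⟩ : ∃ m', m = m' + 1 := ⟨m - 1, by omega⟩
  have hm' := hM (m + 1) (by omega)
  rcases hm with hm | hm
  · exact main i j hij (Or.inl ⟨rfl, rfl⟩) m hm hm'.1
  · exact main j i hij.symm (Or.inr ⟨rfl, rfl⟩) m hm hm'.2

end BowditchSystem

/-- Kőnig's lemma for sets of words that are closed under deletion of the first letter. -/
theorem exists_path_of_infinite {α : Type*} [Finite α] {O : Set (List α)} (hinf : O.Infinite)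
    (htail : ∀ c l, c :: l ∈ O → l ∈ O) :
    ∃ (v : ℕ → List α) (c : ℕ → α), ∀ t, v (t + 1) = c t :: v t ∧ v t ∈ O ∧ (v t).length = t := by
  have happ : ∀ u l, u ++ l ∈ O → l ∈ O := by
    intro u
    induction u with
    | nil => intro l h; exact h
    | cons c u ih => intro l h; exact ih l (htail _ _ h)
  have step : ∀ l : List α, {u | u ++ l ∈ O}.Infinite → ∃ c, {u | u ++ c :: l ∈ O}.Infinite := by
    intro l hl
    by_contra! hc
    apply hl
    refine ((Set.finite_singleton ([] : List α)).union
      (Set.finite_iUnion fun c => ((hc c).image fun u => u ++ [c]))).subset ?_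
    intro u hu
    rcases List.eq_nil_or_concat u with rfl | ⟨u', c, rfl⟩
    · left; rfl
    · right
      rw [Set.mem_iUnion]
      refine ⟨c, u', ?_, by simp⟩
      simpa using hu
  choose g hg using step
  let P : Type _ := {l : List α // {u | u ++ l ∈ O}.Infinite}
  let f : P → P := fun l => ⟨g l.1 l.2 :: l.1, hg l.1 l.2⟩
  let p0 : P := ⟨[], by simpa using hinf⟩
  refine ⟨fun t => (f^[t] p0).1, fun t => g (f^[t] p0).1 (f^[t] p0).2, fun t => ⟨?_, ?_, ?_⟩⟩
  · simp only [Function.iterate_succ_apply']; rfl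
  · obtain ⟨u, hu⟩ := (f^[t] p0).2.nonempty
    exact happ _ _ hu
  · induction t with
    | zero => rfl
    | succ t ih =>
      simp only [Function.iterate_succ_apply']
      change ((f^[t] p0).1).length + 1 = t + 1
      rw [ih]

/-! ### Uniform growth and the direction of distant edges -/

namespace BowditchSystem

variable {μ : ℂ} {X : List (Fin n) → Fin n → ℂ} (S : BowditchSystem n μ X)

include S

/-- Geodesics with |φ| ≤ K have their base vertex in a fixed ball, so there are finitely many and
the constants of `growth_on_geodesic` can be made uniform. -/
theorem growth_of_norm_le {K : ℝ} (hK : ∀ᶠ l in lenTop n, ∀ i j, i ≠ j → Red (i :: l) →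
      Red (j :: l) → K < ‖pairProd X l i j‖) :
    ∃ s < (1 : ℝ), ∀ ε > 0, ∀ᶠ l in lenTop n, ∀ i j, i ≠ j → Red (i :: l) →
      ‖pairProd X l i j‖ ≤ K →
      ‖X l j‖ ^ 2 ≤ s * ‖X (i :: l) i‖ ^ 2 ∧ ‖X l i‖ < ‖X (i :: l) i‖ ∧
        ∀ k, k ≠ i → k ≠ j → ‖X l k‖ ≤ ε * ‖X (i :: l) i‖ := by
  obtain ⟨R, hR⟩ := eventually_lenTop.1 hK
  have h1 : ∀ᶠ s in 𝓝[<] (1 : ℝ), ∀ b ∈ {l : List (Fin n) | l.length < R}, ∀ i j, i ≠ j → Red b →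
      ∀ ε > 0, ∀ᶠ l in lenTop n, Red (i :: l) → strip {i, j} l = b →
      ‖X l j‖ ^ 2 ≤ s * ‖X (i :: l) i‖ ^ 2 ∧ ‖X l i‖ < ‖X (i :: l) i‖ ∧
        ∀ k, k ≠ i → k ≠ j → ‖X l k‖ ≤ ε * ‖X (i :: l) i‖ := by
    rw [eventually_all_finite (List.finite_length_lt _ _)]
    intro b _
    rw [eventually_all]; intro i
    rw [eventually_all]; intro j
    by_cases hij : i = j
    · exact Eventually.of_forall fun _ h => absurd hij h
    by_cases hb : Red b
    swap
    · exact Eventually.of_forall fun _ _ h => absurd h hb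
    obtain ⟨s, hs, h⟩ := S.growth_on_geodesic hij hb
    filter_upwards [Ioo_mem_nhdsLT hs] with s' hs' _ _ ε hε
    filter_upwards [h ε hε] with l hl hred hst
    obtain ⟨h1, h2⟩ := hl hred hst
    exact ⟨h1.trans (mul_le_mul_of_nonneg_right hs'.1.le (by positivity)), h2⟩
  have h2 : ∀ᶠ s in 𝓝[<] (1 : ℝ), s < 1 := eventually_mem_nhdsWithin
  obtain ⟨s, hs, hs1⟩ := (h1.and h2).exists
  refine ⟨s, hs1, fun ε hε => ?_⟩
  have h3 : ∀ᶠ l in lenTop n, ∀ b ∈ {l : List (Fin n) | l.length < R}, ∀ i j, i ≠ j → Red b →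
      Red (i :: l) → strip {i, j} l = b →
      ‖X l j‖ ^ 2 ≤ s * ‖X (i :: l) i‖ ^ 2 ∧ ‖X l i‖ < ‖X (i :: l) i‖ ∧
        ∀ k, k ≠ i → k ≠ j → ‖X l k‖ ≤ ε * ‖X (i :: l) i‖ := by
    rw [eventually_all_finite (List.finite_length_lt _ _)]
    intro b hb
    rw [eventually_all]; intro i
    rw [eventually_all]; intro j
    by_cases hij : i = j
    · exact Eventually.of_forall fun _ h => absurd hij h
    by_cases hb' : Red b
    swap
    · exact Eventually.of_forall fun _ _ h => absurd h hb'
    filter_upwards [hs b hb i j hij hb' ε hε] with l hl _ _ using hl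
  filter_upwards [h3] with l hl i j hij hred hle
  have hi := red_cons_strip (I := {i, j}) (i := i) (by simp) hred.tail
  have hj := red_cons_strip (I := {i, j}) (i := j) (by simp) hred.tail
  refine hl _ ?_ i j hij hi.tail hred rfl
  by_contra hlen
  have := hR _ (not_lt.1 hlen) i j hij hi hj
  rw [S.pairProd_strip] at this
  linarith

/-- If `φ(γ)` is large then at most one of two edges of `γ` at a vertex decreases. -/
theorem norm_lt_of_norm_le {i j : Fin n} (hij : j ≠ i) {l : List (Fin n)}
    (h : ‖X l i‖ ≤ ‖X (i :: l) i‖) (h2 : 2 < ‖pairProd X (i :: l) i j‖) :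
    ‖X (i :: l) j‖ < ‖X (j :: i :: l) j‖ := by
  have e1 := S.edge l i
  rw [← S.coProd_cons, coProd_eq_mul_pairProd X _ hij.symm] at e1
  have e2 := S.edge (i :: l) j
  rw [coProd_eq_mul_pairProd X _ hij, pairProd_comm] at e2
  have n1 := norm_add_le (X l i) (X (i :: l) i)
  rw [e1, norm_mul] at n1
  have n2 := norm_add_le (X (i :: l) j) (X (j :: i :: l) j)
  rw [e2, norm_mul] at n2
  have p1 : 0 < ‖X (i :: l) j‖ := norm_pos_iff.2 (S.ne_zero _ _)
  -- With a = φ(γ) and primes for the far ends of the edges, |a||x_j| ≤ 2|x_i'| and |a||x_i'| ≤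
  -- |x_j| + |x_j'|, so |x_j'| ≥ (|a|²/2 - 1)|x_j| > |x_j|.
  nlinarith [mul_le_mul_of_nonneg_left n1 (norm_nonneg (pairProd X (i :: l) i j)),
    mul_pos p1 (sub_pos.2 h2), mul_pos (mul_pos p1 (sub_pos.2 h2)) (sub_pos.2 h2)]

/-- Far from the root all edges point towards the root. -/
theorem eventually_norm_le : ∀ᶠ l in lenTop n, ∀ i, Red (i :: l) → ‖X l i‖ ≤ ‖X (i :: l) i‖ := by
  obtain ⟨K, hK, hKl⟩ := S.exists_bound
  obtain ⟨s, -, hs⟩ := S.growth_of_norm_le hKl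
  obtain ⟨R, hR⟩ := eventually_lenTop.1 (hs 1 one_pos)
  -- The words whose last edge decreases away from the root. Once an edge does not decrease, none
  -- after it does; adding all short words makes the set closed under deletion of the head.
  set O : Set (List (Fin n)) := {l | Red l ∧ (l.length ≤ R + 1 ∨
    ∃ k l', l = k :: l' ∧ ‖X (k :: l') k‖ < ‖X l' k‖)} with hO
  have htail : ∀ c l, c :: l ∈ O → l ∈ O := by
    rintro c l ⟨hred, hor⟩
    refine ⟨hred.tail, ?_⟩
    by_contra! hcon
    obtain ⟨hlen, hno⟩ := hcon
    rcases hor with hor | ⟨k, l', he, hlt⟩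
    · rw [List.length_cons] at hor; omega
    · obtain ⟨rfl, rfl⟩ := List.cons.inj he
      cases l with
      | nil => simp at hlen
      | cons i l =>
        have hci := (red_cons_cons.1 hred).1
        have hle := hno i l rfl
        by_cases hp : ‖pairProd X (i :: l) c i‖ ≤ K
        · have := (hR (i :: l) (by omega) c i hci hred hp).2.1
          linarith
        · rw [pairProd_comm] at hp
          have := S.norm_lt_of_norm_le hci hle (by linarith)
          linarith
  by_cases hfin : O.Finite
  · obtain ⟨M, hM⟩ := (hfin.image List.length).bddAbove
    rw [eventually_lenTop]
    refine ⟨M, fun l hl i hred => ?_⟩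
    by_contra hlt
    have hmem : i :: l ∈ O := ⟨hred, Or.inr ⟨i, l, rfl, not_le.1 hlt⟩⟩
    have := hM ⟨_, hmem, rfl⟩
    rw [List.length_cons] at this; omega
  exfalso
  obtain ⟨v, c, hv⟩ := exists_path_of_infinite hfin htail
  have hdec : ∀ t, R + 1 ≤ t → ‖X (v (t + 1)) (c t)‖ < ‖X (v t) (c t)‖ := by
    intro t ht
    obtain ⟨-, hor⟩ := (hv (t + 1)).2.1
    rcases hor with hor | ⟨k, l', he, hlt⟩
    · rw [(hv (t + 1)).2.2] at hor; omega
    · rw [(hv t).1] at he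
      obtain ⟨rfl, rfl⟩ := List.cons.inj he
      rw [(hv t).1]; exact hlt
  have hlim : ∀ k, ∃ L, Tendsto (fun t => ‖X (v t) k‖) atTop (𝓝 L) := by
    intro k
    have hanti : Antitone fun t => ‖X (v (t + (R + 1))) k‖ := by
      refine antitone_nat_of_succ_le fun t => ?_
      have e : t + 1 + (R + 1) = (t + (R + 1)) + 1 := by omega
      rw [e]
      by_cases hk : k = c (t + (R + 1))
      · rw [hk]; exact (hdec _ (by omega)).le
      · rw [(hv _).1, S.of_ne _ _ _ hk]
    have h := tendsto_atTop_ciInf hanti ⟨0, by rintro _ ⟨t, rfl⟩; exact norm_nonneg _⟩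
    exact ⟨_, (tendsto_add_atTop_iff_nat (R + 1)).1 h⟩
  choose L hL using hlim
  -- Each coordinate is a factor of some φ(γ), and these are bounded away from 0.
  have hL0 : ∀ k, 0 < L k := by
    intro k
    refine lt_of_le_of_ne (ge_of_tendsto' (hL k) fun t => norm_nonneg _) (Ne.symm ?_)
    intro hk0
    obtain ⟨i, hi, -⟩ := exists_ne_ne S.three_le k k
    obtain ⟨j, hj, hji⟩ := exists_ne_ne S.three_le k i
    obtain ⟨ε, hε, hlow⟩ := S.exists_le_norm_pairProd
    have h1 : Tendsto (fun t => ‖pairProd X (v t) i j‖) atTop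
        (𝓝 (∏ m ∈ ({i, j} : Finset (Fin n))ᶜ, L m)) := by
      unfold pairProd
      simp_rw [norm_prod]
      exact tendsto_finsetProd _ fun m _ => hL m
    have h2 := ge_of_tendsto' h1 fun t => hlow _ i j (hv t).2.1.1 hji.symm
    rw [Finset.prod_eq_zero (i := k) (by simp [hi.symm, hj.symm]) hk0] at h2
    linarith
  -- Consecutive values of a coordinate have ratio tending to 1, and 4 < K².
  have hev : ∀ᶠ t in atTop, ∀ k, 4 * ‖X (v t) k‖ < K ^ 2 * ‖X (v (t + 1)) k‖ := by
    rw [eventually_all]; intro k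
    refine ((hL k).const_mul 4).eventually_lt
      (((hL k).comp (tendsto_add_atTop_nat 1)).const_mul (K ^ 2)) ?_
    exact mul_lt_mul_of_pos_right (by nlinarith) (hL0 k)
  obtain ⟨t, ht, htR⟩ := (hev.and (eventually_ge_atTop (R + 1))).exists
  have hne : c (t + 1) ≠ c t := by
    have := (hv (t + 2)).2.1.1
    rw [(hv (t + 1)).1, (hv t).1] at this
    exact (red_cons_cons.1 this).1
  have hred : Red (c (t + 1) :: v (t + 1)) := by rw [← (hv (t + 1)).1]; exact (hv _).2.1.1
  have d1 := hdec t htR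
  have d2 := hdec (t + 1) (by omega)
  have e1 := S.edge (v t) (c t)
  rw [← S.coProd_cons, ← (hv t).1, coProd_eq_mul_pairProd X _ hne.symm, pairProd_comm] at e1
  have e2 := S.edge (v (t + 1)) (c (t + 1))
  rw [← (hv (t + 1)).1, coProd_eq_mul_pairProd X _ hne] at e2
  by_cases hp : ‖pairProd X (v (t + 1)) (c (t + 1)) (c t)‖ ≤ K
  · have := (hR (v (t + 1)) (by rw [(hv _).2.2]; omega) _ _ hne hred hp).2.1
    rw [← (hv (t + 1)).1] at this
    linarith
  -- On a geodesic with |φ| > K two successive decreasing edges each cost a factor K/2, which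
  -- contradicts `ht`.
  · have n1 := norm_add_le (X (v t) (c t)) (X (v (t + 1)) (c t))
    rw [e1, norm_mul] at n1
    have n2 := norm_add_le (X (v (t + 1)) (c (t + 1))) (X (v (t + 2)) (c (t + 1)))
    rw [e2, norm_mul] at n2
    have := ht (c t)
    push Not at hp
    have q1 : K * ‖X (v (t + 1)) (c (t + 1))‖ ≤ 2 * ‖X (v t) (c t)‖ := by
      nlinarith [norm_nonneg (X (v (t + 1)) (c (t + 1)))]
    have q2 : K * ‖X (v (t + 1)) (c t)‖ ≤ 2 * ‖X (v (t + 1)) (c (t + 1))‖ := by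
      nlinarith [norm_nonneg (X (v (t + 1)) (c t))]
    nlinarith

end BowditchSystem

/-! ### The principal square root and the half-summand -/

theorem sqrt_re_pos {w : ℂ} (hw : w ∈ Complex.slitPlane) : 0 < (w ^ (1 / 2 : ℂ)).re := by
  have h0 : w ≠ 0 := Complex.slitPlane_ne_zero hw
  rw [Complex.cpow_def_of_ne_zero h0, Complex.exp_re]
  refine mul_pos (Real.exp_pos _) (Real.cos_pos_of_mem_Ioo ?_)
  have e : (Complex.log w * (1 / 2)).im = w.arg / 2 := by
    have : (Complex.log w * (1 / 2)) = Complex.log w * ((1 / 2 : ℝ) : ℂ) := by push_cast; ring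
    rw [this, Complex.im_mul_ofReal, Complex.log_im]; ring
  rw [e]
  have h1 := Complex.neg_pi_lt_arg w
  have h2 := Complex.arg_le_pi w
  have h3 := (Complex.mem_slitPlane_iff_arg.1 hw).1
  have h4 := lt_of_le_of_ne h2 h3
  constructor <;> linarith

theorem sqrt_sq (w : ℂ) : (w ^ (1 / 2 : ℂ)) ^ 2 = w := by
  simp

/-- Half the summand for `q = 0`: `η(a) = (1 - √(1 - 4 / a²)) / 2`. -/
def eta (a : ℂ) : ℂ := (1 - (1 - 4 / a ^ 2) ^ (1 / 2 : ℂ)) / 2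

/-- If 1 - 4/a² = r ≤ 0 then a = ±2/√(1 - r), which lies in [-2, 2]. -/
theorem one_sub_mem_slitPlane {a : ℂ} (ha : ∀ t : ℝ, t ∈ Set.Icc (-2 : ℝ) 2 → a ≠ t) :
    1 - 4 / a ^ 2 ∈ Complex.slitPlane := by
  by_contra h
  rw [Complex.mem_slitPlane_iff] at h
  push Not at h
  have ha0 : a ≠ 0 := by simpa using ha 0 (by norm_num)
  set r := (1 - 4 / a ^ 2).re with hr
  have e : 1 - 4 / a ^ 2 = (r : ℂ) := by apply Complex.ext <;> simp [hr, h.2]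
  have hr0 : r ≤ 0 := h.1
  have hpos : (0 : ℝ) < 1 - r := by linarith
  have e2 : a ^ 2 = ((2 / √(1 - r) : ℝ) : ℂ) ^ 2 := by
    have h1 : (4 : ℂ) / a ^ 2 = ((1 - r : ℝ) : ℂ) := by push_cast; rw [← e]; ring
    have h2 : ((1 - r : ℝ) : ℂ) ≠ 0 := by exact_mod_cast hpos.ne'
    rw [← Complex.ofReal_pow, div_pow, Real.sq_sqrt hpos.le, Complex.ofReal_div, ← h1]
    push_cast
    have : a ^ 2 ≠ 0 := pow_ne_zero 2 ha0
    field_simp; norm_num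
  have hs : 1 ≤ √(1 - r) := Real.one_le_sqrt.2 (by linarith)
  have hle : 2 / √(1 - r) ≤ 2 := div_le_self (by norm_num) hs
  have hge : 0 ≤ 2 / √(1 - r) := by positivity
  rcases sq_eq_sq_iff_eq_or_eq_neg.1 e2 with h' | h'
  · exact ha _ ⟨by linarith, hle⟩ h'
  · refine ha (-(2 / √(1 - r))) ⟨by linarith, by linarith⟩ ?_
    rw [h']; push_cast; ring

theorem eta_mul_one_sub (a : ℂ) : eta a * (1 - eta a) = 1 / a ^ 2 := by
  unfold eta
  have := sqrt_sq (1 - 4 / a ^ 2)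
  linear_combination (-1 / 4) * this

theorem re_eta_lt {a : ℂ} (ha : ∀ t : ℝ, t ∈ Set.Icc (-2 : ℝ) 2 → a ≠ t) :
    (eta a).re < 1 / 2 := by
  have h := sqrt_re_pos (one_sub_mem_slitPlane ha)
  have e : eta a = ((1 / 2 : ℝ) : ℂ) * (1 - (1 - 4 / a ^ 2) ^ (1 / 2 : ℂ)) := by
    unfold eta; push_cast; ring
  rw [e, Complex.re_ofReal_mul, Complex.sub_re, Complex.one_re]
  linarith

/-- The choice of branch gives Re η < 1/2, hence |1 - η| ≥ 1/2; now use η(1 - η) = 1/a². -/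
theorem norm_eta_le {a : ℂ} (ha : ∀ t : ℝ, t ∈ Set.Icc (-2 : ℝ) 2 → a ≠ t) :
    ‖eta a‖ ≤ (4 / ‖a‖ ^ 2) / 2 := by
  have h1 := re_eta_lt ha
  have h2 := congrArg norm (eta_mul_one_sub a)
  rw [norm_mul, norm_div, norm_one, norm_pow] at h2
  have h3 := Complex.re_le_norm (1 - eta a)
  rw [Complex.sub_re, Complex.one_re] at h3
  have h4 : (4 / ‖a‖ ^ 2) / 2 = 2 * (1 / ‖a‖ ^ 2) := by ring
  rw [h4, ← h2]
  nlinarith [norm_nonneg (eta a)]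

/-! ### Weights of geodesics and contraction -/

/-- The weight `4 / |φ(γ)|²` of the geodesic with colours `i`, `j` through a vertex. -/
def geoWeight (X : List (Fin n) → Fin n → ℂ) (l : List (Fin n)) (i j : Fin n) : ℝ :=
  4 / ‖pairProd X l i j‖ ^ 2

/-- The factor by which the weights change along consecutive edges of colours `i` and `j`. -/
def turnRatio (X : List (Fin n) → Fin n → ℂ) (l : List (Fin n)) (i j : Fin n) : ℝ :=
  ‖X l j‖ ^ 2 / ‖X (i :: l) i‖ ^ 2

theorem geoWeight_nonneg (X : List (Fin n) → Fin n → ℂ) (l : List (Fin n)) (i j : Fin n) :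
    0 ≤ geoWeight X l i j := by unfold geoWeight; positivity

theorem turnRatio_nonneg (X : List (Fin n) → Fin n → ℂ) (l : List (Fin n)) (i j : Fin n) :
    0 ≤ turnRatio X l i j := by unfold turnRatio; positivity

theorem geoWeight_comm (X : List (Fin n) → Fin n → ℂ) (l : List (Fin n)) (i j : Fin n) :
    geoWeight X l i j = geoWeight X l j i := by unfold geoWeight; rw [pairProd_comm]

theorem eventually_lenTop_of_cons {P : List (Fin n) → Prop}
    (h : ∀ᶠ l in lenTop n, ∀ i, P (i :: l)) : ∀ᶠ l in lenTop n, P l := by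
  obtain ⟨R, hR⟩ := eventually_lenTop.1 h
  refine eventually_lenTop.2 ⟨R + 1, fun l hl => ?_⟩
  cases l with
  | nil => simp at hl
  | cons i l => exact hR l (by simpa using hl) i

theorem red_cons_or {j k : Fin n} (h : j ≠ k) {l : List (Fin n)} (hl : Red l) :
    Red (j :: l) ∨ Red (k :: l) := by
  cases l with
  | nil => left; simp
  | cons g l =>
    simp only [red_cons_cons]
    by_cases hg : j = g
    · right; exact ⟨by rintro rfl; exact h hg, hl⟩
    · left; exact ⟨hg, hl⟩

namespace BowditchSystem

variable {μ : ℂ} {X : List (Fin n) → Fin n → ℂ} (S : BowditchSystem n μ X)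

include S

theorem geoWeight_cons_left (l : List (Fin n)) (i j : Fin n) :
    geoWeight X (i :: l) j i = geoWeight X l i j := by
  rw [geoWeight_comm]; unfold geoWeight; rw [S.pairProd_cons]

/-- Both sides are the product of all coordinates at the vertex `i :: l`. -/
theorem mul_coProd_cons (l : List (Fin n)) {i j : Fin n} (hj : j ≠ i) :
    X l j * coProd X (i :: l) j = X (i :: l) i * coProd X l i := by
  rw [← S.coProd_cons i l, ← prod_eq_mul_coProd, prod_eq_mul_coProd X (i :: l) j, S.of_ne _ _ _ hj]

theorem mul_pairProd_cons (l : List (Fin n)) {i j k : Fin n} (hj : j ≠ i) (hk : k ≠ i)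
    (hjk : j ≠ k) : X l j * pairProd X (i :: l) j k = X (i :: l) i * pairProd X l i k := by
  have h := S.mul_coProd_cons l hj
  rw [coProd_eq_mul_pairProd X (i :: l) hjk, coProd_eq_mul_pairProd X l hk.symm,
    S.of_ne _ _ _ hk] at h
  have := S.ne_zero l k
  apply mul_left_cancel₀ this
  linear_combination h

theorem geoWeight_cons (l : List (Fin n)) {i j k : Fin n} (hj : j ≠ i) (hk : k ≠ i)
    (hjk : j ≠ k) : geoWeight X (i :: l) j k = turnRatio X l i j * geoWeight X l i k := by
  have h := congrArg norm (S.mul_pairProd_cons l hj hk hjk)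
  rw [norm_mul, norm_mul] at h
  have h1 := norm_ne_zero_iff.2 (S.ne_zero l j)
  have h2 := norm_ne_zero_iff.2 (S.ne_zero (i :: l) i)
  have h3 := norm_ne_zero_iff.2 (S.pairProd_ne_zero hjk (i :: l))
  have h4 := norm_ne_zero_iff.2 (S.pairProd_ne_zero hk.symm l)
  unfold geoWeight turnRatio
  rw [div_mul_div_comm, div_eq_div_iff (by positivity) (by positivity), ← mul_pow, ← h, mul_pow]
  ring

theorem norm_coProd_le {l : List (Fin n)} {i : Fin n} (h : ‖X l i‖ ≤ ‖X (i :: l) i‖) :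
    ‖coProd X l i‖ ≤ 2 * ‖X (i :: l) i‖ := by
  rw [← S.edge]
  have := norm_add_le (X l i) (X (i :: l) i)
  linarith

/-- Since the edge points towards the root, |x_j||φ(γ)| = |x_i + x_i'| ≤ 2|x_i'|. -/
theorem turnRatio_le {l : List (Fin n)} {i j : Fin n} (hj : j ≠ i)
    (h : ‖X l i‖ ≤ ‖X (i :: l) i‖) : turnRatio X l i j ≤ geoWeight X l i j := by
  have h1 := S.norm_coProd_le h
  rw [coProd_eq_mul_pairProd X l hj.symm, norm_mul] at h1
  have h2 := norm_pos_iff.2 (S.ne_zero (i :: l) i)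
  have h3 := norm_pos_iff.2 (S.pairProd_ne_zero hj.symm l)
  unfold turnRatio geoWeight
  rw [div_le_div_iff₀ (by positivity) (by positivity)]
  have := pow_le_pow_left₀ (by positivity) h1 2
  nlinarith

/-- Only finitely many geodesics have weight at least `δ`. -/
theorem eventually_geoWeight_le {δ : ℝ} (hδ : 0 < δ) : ∀ᶠ l in lenTop n, ∀ j k, j ≠ k →
    Red (j :: l) → Red (k :: l) → geoWeight X l j k ≤ δ := by
  obtain ⟨K, hK, hKl⟩ := S.exists_bound
  obtain ⟨ε₀, hε₀, hlow⟩ := S.exists_le_norm_pairProd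
  set ρ : ℝ := 4 / K ^ 2 with hρ
  have hρ0 : 0 < ρ := by positivity
  have hρ1 : ρ < 1 := by rw [hρ, div_lt_one (by positivity)]; nlinarith
  have hbig : ∀ l i j, K < ‖pairProd X l i j‖ → geoWeight X l i j ≤ ρ := by
    intro l i j h
    unfold geoWeight
    exact div_le_div_of_nonneg_left (by norm_num) (by positivity)
      (pow_le_pow_left₀ (by linarith) h.le 2)
  obtain ⟨s, -, hs⟩ := S.growth_of_norm_le hKl
  -- Bootstrapping: moving out one level gains a factor ρ. A new geodesic with colours j, k at `i ::
  -- l` is compared with those through the edge i, and l is the base vertex of the one with colours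
  -- i, k.
  have key : ∀ a : ℕ, ∀ᶠ l in lenTop n, ∀ j k, j ≠ k → Red (j :: l) → Red (k :: l) →
      geoWeight X l j k ≤ ρ ^ (a + 1) := by
    intro a
    induction a with
    | zero =>
      filter_upwards [hKl] with l hl j k hjk hj hk
      rw [zero_add, pow_one]
      exact hbig _ _ _ (hl j k hjk hj hk)
    | succ a ih =>
      -- Chosen so that ε² · 4/ε₀² = ρ^(a + 2), which is what the case of a geodesic with |φ| ≤ K
      -- needs.
      set ε : ℝ := √(ρ ^ (a + 2) * ε₀ ^ 2 / 4) with hε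
      have hε0 : 0 < ε := Real.sqrt_pos.2 (by positivity)
      have hεsq : ε ^ 2 = ρ ^ (a + 2) * ε₀ ^ 2 / 4 := Real.sq_sqrt (by positivity)
      apply eventually_lenTop_of_cons
      filter_upwards [ih, S.eventually_norm_le, hs ε hε0] with l hl hin hray i
      have main : ∀ j k, j ≠ k → j ≠ i → k ≠ i → Red (i :: l) → Red (k :: l) →
          geoWeight X (i :: l) j k ≤ ρ ^ (a + 2) := by
        intro j k hjk hj hk hi hkl
        by_cases hp : ‖pairProd X l i j‖ ≤ K
        · rw [geoWeight_comm, S.geoWeight_cons l hk hj hjk.symm]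
          have h1 := (hray i j hj.symm hi hp).2.2 k hk hjk.symm
          have h2 := norm_pos_iff.2 (S.ne_zero (i :: l) i)
          have h3 : turnRatio X l i k ≤ ε ^ 2 := by
            unfold turnRatio
            rw [div_le_iff₀ (by positivity), ← mul_pow]
            exact pow_le_pow_left₀ (norm_nonneg _) h1 2
          have h4 : geoWeight X l i j ≤ 4 / ε₀ ^ 2 := by
            unfold geoWeight
            exact div_le_div_of_nonneg_left (by norm_num) (by positivity)
              (pow_le_pow_left₀ hε₀.le (hlow l i j hi.tail hj.symm) 2)
          refine (mul_le_mul h3 h4 (geoWeight_nonneg _ _ _ _) (by positivity)).trans_eq ?_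
          rw [hεsq]; field_simp
        · rw [S.geoWeight_cons l hj hk hjk, pow_succ' ρ (a + 1)]
          exact mul_le_mul ((S.turnRatio_le hj (hin i hi)).trans (hbig _ _ _ (not_le.1 hp)))
            (hl i k hk.symm hi hkl) (geoWeight_nonneg _ _ _ _) hρ0.le
      intro j k hjk hj hk
      have hj' := red_cons_cons.1 hj
      have hk' := red_cons_cons.1 hk
      rcases red_cons_or hjk hj'.2.tail with h | h
      · rw [geoWeight_comm]; exact main k j hjk.symm hk'.1 hj'.1 hj'.2 h
      · exact main j k hjk hj'.1 hk'.1 hj'.2 h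
  obtain ⟨a, ha⟩ := exists_pow_lt_of_lt_one hδ hρ1
  filter_upwards [key a] with l hl j k hjk hj hk
  refine (hl j k hjk hj hk).trans (le_trans ?_ ha.le)
  exact pow_le_pow_of_le_one hρ0.le hρ1.le (Nat.le_succ a)

/-- Far from the root all but one of the geodesics through an edge have small weight. -/
theorem eventually_exists_exceptional {δ : ℝ} (hδ : 0 < δ) : ∀ᶠ l in lenTop n, ∀ i, Red (i :: l) →
    ∃ g, g ≠ i ∧ ∀ j, j ≠ i → j ≠ g → geoWeight X l i j ≤ δ := by
  filter_upwards [S.eventually_geoWeight_le hδ, eventually_lenTop_of_cons (P := fun l => l ≠ [])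
    (Eventually.of_forall fun l i => List.cons_ne_nil i l)] with l hl hne i hi
  cases l with
  | nil => exact absurd rfl hne
  | cons g l =>
    -- The exceptional colour is that of the edge towards the root; for any other j the vertex is
    -- the base of the geodesic.
    exact ⟨g, (red_cons_cons.1 hi).1.symm, fun j hji hjg =>
      hl i j hji.symm hi (red_cons_cons.2 ⟨hjg, hi.tail⟩)⟩

/-- Only the exceptional colour has a ratio that need not be small. It is at most s by growth if |φ|
≤ K, and at most 4/K² otherwise; the other terms share half of the remaining gap to 1. -/
theorem eventually_sum_turnRatio_le : ∃ s < (1 : ℝ), ∀ᶠ l in lenTop n, ∀ i, Red (i :: l) →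
    ∑ j ∈ ({i} : Finset (Fin n))ᶜ, turnRatio X l i j ≤ s := by
  obtain ⟨K, hK, hKl⟩ := S.exists_bound
  obtain ⟨s, hs1, hs⟩ := S.growth_of_norm_le hKl
  have hρ1 : 4 / K ^ 2 < 1 := by rw [div_lt_one (by positivity)]; nlinarith
  set r := max s (4 / K ^ 2) with hr
  have hr1 : r < 1 := max_lt hs1 hρ1
  have hn : (0 : ℝ) < n := by have := S.three_le; exact_mod_cast (by omega : 0 < n)
  set δ := (1 - r) / (2 * n) with hδ
  have hδ0 : 0 < δ := by have := sub_pos.2 hr1; positivity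
  refine ⟨r + n * δ, ?_, ?_⟩
  · rw [hδ]
    have : (n : ℝ) * ((1 - r) / (2 * n)) = (1 - r) / 2 := by field_simp
    rw [this]; linarith
  filter_upwards [S.eventually_exists_exceptional hδ0, S.eventually_norm_le, hs 1 one_pos]
    with l hl hin hray i hi
  obtain ⟨g, hgi, hg⟩ := hl i hi
  have hmem : g ∈ ({i} : Finset (Fin n))ᶜ := by simpa using hgi
  rw [← Finset.add_sum_erase _ _ hmem]
  apply add_le_add
  · by_cases hp : ‖pairProd X l i g‖ ≤ K
    · have h1 := (hray i g hgi.symm hi hp).1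
      refine le_trans ?_ (le_max_left _ _)
      unfold turnRatio
      rwa [div_le_iff₀ (pow_pos (norm_pos_iff.2 (S.ne_zero _ _)) 2)]
    · refine ((S.turnRatio_le hgi (hin i hi)).trans ?_).trans (le_max_right _ _)
      unfold geoWeight
      exact div_le_div_of_nonneg_left (by norm_num) (by positivity)
        (pow_le_pow_left₀ (by linarith) (not_le.1 hp).le 2)
  · refine (Finset.sum_le_card_nsmul _ _ δ fun j hj => ?_).trans ?_
    · rw [Finset.mem_erase, Finset.mem_compl, Finset.mem_singleton] at hj
      exact (S.turnRatio_le hj.2 (hin i hi)).trans (hg j hj.2 hj.1)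
    · rw [nsmul_eq_mul]
      refine mul_le_mul_of_nonneg_right ?_ hδ0.le
      exact_mod_cast (Finset.card_le_univ _).trans_eq (Fintype.card_fin n)

/-- The real parts of the half-summands are bounded away from `1/2`. -/
theorem exists_re_eta_le : ∃ c > 0, ∀ l i j, Red l → i ≠ j →
    (eta (pairProd X l i j)).re ≤ 1 / 2 - c := by
  obtain ⟨K, hK, h⟩ := S.exists_bound
  obtain ⟨R, hR⟩ := eventually_lenTop.1 h
  have h1 : ∀ᶠ c in 𝓝[>] (0 : ℝ), ∀ l ∈ {l : List (Fin n) | l.length < R}, ∀ i j, i ≠ j →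
      (eta (pairProd X l i j)).re ≤ 1 / 2 - c := by
    rw [eventually_all_finite (List.finite_length_lt _ _)]
    intro l _
    rw [eventually_all]; intro i
    rw [eventually_all]; intro j
    by_cases hij : i = j
    · exact Eventually.of_forall fun _ h => absurd hij h
    · have := re_eta_lt (S.pair_ne l i j hij)
      filter_upwards [Ioo_mem_nhdsGT (sub_pos.2 this)] with ε hε _
      have := hε.2
      linarith
  have hρ1 : 4 / K ^ 2 < 1 := by rw [div_lt_one (by positivity)]; nlinarith
  have h2 : ∀ᶠ c in 𝓝[>] (0 : ℝ), c ∈ Set.Ioo (0 : ℝ) (1 / 2 - 4 / K ^ 2 / 2) :=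
    Ioo_mem_nhdsGT (by linarith)
  obtain ⟨c, hc, h0, hc2⟩ := (h1.and h2).exists
  refine ⟨c, h0, fun l i j hl hij => ?_⟩
  rw [← S.pairProd_strip]
  by_cases hb : R ≤ (strip {i, j} l).length
  · have h3 := hR _ hb i j hij (red_cons_strip (by simp) hl) (red_cons_strip (by simp) hl)
    have h4 := (Complex.re_le_norm _).trans (norm_eta_le (S.pair_ne (strip {i, j} l) i j hij))
    have h5 : 4 / ‖pairProd X (strip {i, j} l) i j‖ ^ 2 ≤ 4 / K ^ 2 :=
      div_le_div_of_nonneg_left (by norm_num) (by positivity)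
        (pow_le_pow_left₀ (by linarith) h3.le 2)
    linarith
  · exact hc _ (not_le.1 hb) i j hij

end BowditchSystem

/-! ### Levels of the tree -/

/-- The colours of the edges that lead away from the root. -/
def kids (l : List (Fin n)) : Finset (Fin n) := {i | Red (i :: l)}

theorem mem_kids {l : List (Fin n)} {i : Fin n} : i ∈ kids l ↔ Red (i :: l) := by simp [kids]

theorem kids_nil : kids ([] : List (Fin n)) = Finset.univ := by ext i; simp [mem_kids]

theorem kids_cons {i : Fin n} {l : List (Fin n)} (h : Red (i :: l)) :
    kids (i :: l) = {i}ᶜ := by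
  ext j; simp only [mem_kids, red_cons_cons, Finset.mem_compl, Finset.mem_singleton]; tauto

/-- The reduced words of length `d`. -/
def sph (n : ℕ) : ℕ → Finset (List (Fin n))
  | 0 => {[]}
  | d + 1 => (sph n d).biUnion fun l => (kids l).image (· :: l)

theorem mem_sph {d : ℕ} {l : List (Fin n)} : l ∈ sph n d ↔ Red l ∧ l.length = d := by
  induction d generalizing l with
  | zero =>
    simp only [sph, Finset.mem_singleton, List.length_eq_zero_iff]
    exact ⟨fun h => ⟨h ▸ List.IsChain.nil, h⟩, fun h => h.2⟩
  | succ d ih =>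
    simp only [sph, Finset.mem_biUnion, Finset.mem_image, ih, mem_kids]
    constructor
    · rintro ⟨l, ⟨-, h⟩, i, hi, rfl⟩
      exact ⟨hi, by simp [h]⟩
    · rintro ⟨h1, h2⟩
      cases l with
      | nil => simp at h2
      | cons i l => exact ⟨l, ⟨h1.tail, by simpa using h2⟩, i, h1, rfl⟩

/-- The sum over the edges from level `d` to level `d + 1`. -/
def edgeSum {M : Type*} [AddCommMonoid M] (d : ℕ) (F : List (Fin n) → Fin n → M) : M :=
  ∑ l ∈ sph n d, ∑ i ∈ kids l, F l i

theorem sum_sph_succ {M : Type*} [AddCommMonoid M] (d : ℕ) (F : List (Fin n) → M) :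
    ∑ l ∈ sph n (d + 1), F l = edgeSum d fun l i => F (i :: l) := by
  unfold edgeSum
  rw [sph, Finset.sum_biUnion]
  · refine Finset.sum_congr rfl fun l _ => Finset.sum_image ?_
    intro i _ j _ h
    exact (List.cons.inj h).1
  · intro l _ l' _ hne
    rw [Function.onFun, Finset.disjoint_left]
    intro w hw hw'
    obtain ⟨i, -, rfl⟩ := Finset.mem_image.1 hw
    obtain ⟨j, -, h⟩ := Finset.mem_image.1 hw'
    exact hne (List.cons.inj h).2.symm

theorem edgeSum_succ {M : Type*} [AddCommMonoid M] (d : ℕ) (F : List (Fin n) → Fin n → M) :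
    edgeSum (d + 1) F = edgeSum d fun l i => ∑ j ∈ ({i} : Finset (Fin n))ᶜ, F (i :: l) j := by
  have := sum_sph_succ d fun l : List (Fin n) => ∑ i ∈ kids l, F l i
  unfold edgeSum at *
  rw [this]
  refine Finset.sum_congr rfl fun l _ => Finset.sum_congr rfl fun i hi => ?_
  simp only [kids_cons (mem_kids.1 hi)]

theorem edgeSum_congr {M : Type*} [AddCommMonoid M] {d : ℕ} {F G : List (Fin n) → Fin n → M}
    (h : ∀ l i, l.length = d → Red (i :: l) → F l i = G l i) : edgeSum d F = edgeSum d G :=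
  Finset.sum_congr rfl fun l hl => Finset.sum_congr rfl fun i hi =>
    h l i (mem_sph.1 hl).2 (mem_kids.1 hi)

theorem edgeSum_le {d : ℕ} {F G : List (Fin n) → Fin n → ℝ}
    (h : ∀ l i, l.length = d → Red (i :: l) → F l i ≤ G l i) : edgeSum d F ≤ edgeSum d G :=
  Finset.sum_le_sum fun l hl => Finset.sum_le_sum fun i hi =>
    h l i (mem_sph.1 hl).2 (mem_kids.1 hi)

theorem edgeSum_nonneg {d : ℕ} {F : List (Fin n) → Fin n → ℝ} (h : ∀ l i, 0 ≤ F l i) :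
    0 ≤ edgeSum d F := Finset.sum_nonneg fun l _ => Finset.sum_nonneg fun i _ => h l i

theorem edgeSum_mul_left (d : ℕ) (c : ℝ) (F : List (Fin n) → Fin n → ℝ) :
    edgeSum d (fun l i => c * F l i) = c * edgeSum d F := by
  unfold edgeSum; simp_rw [Finset.mul_sum]

theorem norm_edgeSum_le (d : ℕ) (F : List (Fin n) → Fin n → ℂ) :
    ‖edgeSum d F‖ ≤ edgeSum d fun l i => ‖F l i‖ :=
  (norm_sum_le _ _).trans (Finset.sum_le_sum fun _ _ => norm_sum_le _ _)

theorem edgeSum_add {M : Type*} [AddCommMonoid M] (d : ℕ) (F G : List (Fin n) → Fin n → M) :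
    edgeSum d (fun l i => F l i + G l i) = edgeSum d F + edgeSum d G := by
  unfold edgeSum; simp_rw [Finset.sum_add_distrib]

theorem edgeSum_sub (d : ℕ) (F G : List (Fin n) → Fin n → ℂ) :
    edgeSum d (fun l i => F l i - G l i) = edgeSum d F - edgeSum d G := by
  unfold edgeSum; simp_rw [Finset.sum_sub_distrib]

/-- The vertices of the tree, as reduced words. -/
abbrev RedWord (n : ℕ) : Type := {l : List (Fin n) // Red l}

/-- The vertices sorted by level. -/
def levelEquiv (n : ℕ) : (Σ d, {l // l ∈ sph n d}) ≃ RedWord n where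
  toFun x := ⟨x.2.1, (mem_sph.1 x.2.2).1⟩
  invFun v := ⟨v.1.length, v.1, mem_sph.2 ⟨v.2, rfl⟩⟩
  left_inv := by
    rintro ⟨d, l, hl⟩
    obtain rfl := (mem_sph.1 hl).2
    rfl
  right_inv _ := rfl

theorem summable_of_summable_levels {f : List (Fin n) → ℝ} (hf : ∀ l, 0 ≤ f l)
    (h : Summable fun d => ∑ l ∈ sph n d, f l) : Summable fun v : RedWord n => f v.1 := by
  rw [← (levelEquiv n).summable_iff]
  refine (summable_sigma_of_nonneg (f := (fun v : RedWord n => f v.1) ∘ levelEquiv n)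
    fun _ => hf _).2 ⟨fun d => Summable.of_finite, ?_⟩
  refine h.congr fun d => ?_
  rw [← Finset.tsum_subtype]
  rfl

theorem tendsto_sum_levels {f : List (Fin n) → ℂ} (h : Summable fun v : RedWord n => f v.1) :
    Tendsto (fun D => ∑ d ∈ Finset.range D, ∑ l ∈ sph n d, f l) atTop
      (𝓝 (∑' v : RedWord n, f v.1)) := by
  have h1 := (levelEquiv n).hasSum_iff.2 h.hasSum
  have h2 := h1.sigma (g := fun d => ∑ l ∈ sph n d, f l) fun d => by
    have := hasSum_fintype fun l : {l // l ∈ sph n d} => f l.1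
    rw [Finset.sum_coe_sort (sph n d) f] at this
    exact this
  exact h2.tendsto_sum_nat

theorem sum_sum_erase_mul {ι R : Type*} [DecidableEq ι] [CommRing R] (s : Finset ι) (f : ι → R) :
    ∑ j ∈ s, ∑ k ∈ s.erase j, f j * f k = (∑ j ∈ s, f j) ^ 2 - ∑ j ∈ s, f j ^ 2 := by
  rw [sq, Finset.sum_mul, ← Finset.sum_sub_distrib]
  refine Finset.sum_congr rfl fun j hj => ?_
  rw [← Finset.mul_sum, ← Finset.add_sum_erase _ _ hj]
  ring

/-! ### Summability -/

/-- The sum of the products of the weights of two geodesics through an edge. -/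
def crossWeight (X : List (Fin n) → Fin n → ℂ) (l : List (Fin n)) (i : Fin n) : ℝ :=
  (∑ j ∈ ({i} : Finset (Fin n))ᶜ, geoWeight X l i j) ^ 2
    - ∑ j ∈ ({i} : Finset (Fin n))ᶜ, geoWeight X l i j ^ 2

/-- The weight of an edge. -/
def edgeWeight (X : List (Fin n) → Fin n → ℂ) (l : List (Fin n)) (i : Fin n) : ℝ :=
  1 / ‖coProd X l i‖ ^ 2 + crossWeight X l i

theorem crossWeight_nonneg (X : List (Fin n) → Fin n → ℂ) (l : List (Fin n)) (i : Fin n) :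
    0 ≤ crossWeight X l i := by
  unfold crossWeight
  rw [← sum_sum_erase_mul]
  exact Finset.sum_nonneg fun j _ => Finset.sum_nonneg fun k _ =>
    mul_nonneg (geoWeight_nonneg _ _ _ _) (geoWeight_nonneg _ _ _ _)

theorem edgeWeight_nonneg (X : List (Fin n) → Fin n → ℂ) (l : List (Fin n)) (i : Fin n) :
    0 ≤ edgeWeight X l i := by
  have := crossWeight_nonneg X l i
  unfold edgeWeight; positivity

/-- The sum of the half-summands of the geodesics for which a vertex is closest to the root;
each geodesic occurs twice. -/
def newSum (X : List (Fin n) → Fin n → ℂ) (l : List (Fin n)) : ℂ :=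
  ∑ j ∈ kids l, ∑ k ∈ (kids l).erase j, eta (pairProd X l j k)

/-- The sum of the norms in `newSum`. -/
def newNorm (X : List (Fin n) → Fin n → ℂ) (l : List (Fin n)) : ℝ :=
  ∑ j ∈ kids l, ∑ k ∈ (kids l).erase j, ‖eta (pairProd X l j k)‖

theorem norm_newSum_le (X : List (Fin n) → Fin n → ℂ) (l : List (Fin n)) :
    ‖newSum X l‖ ≤ newNorm X l :=
  (norm_sum_le _ _).trans (Finset.sum_le_sum fun _ _ => norm_sum_le _ _)

theorem newNorm_nonneg (X : List (Fin n) → Fin n → ℂ) (l : List (Fin n)) : 0 ≤ newNorm X l :=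
  (norm_nonneg _).trans (norm_newSum_le X l)

theorem compl_singleton_eq_insert {i j : Fin n} (h : j ≠ i) :
    ({i} : Finset (Fin n))ᶜ = insert j ({i, j} : Finset (Fin n))ᶜ := by
  ext k; simp only [Finset.mem_compl, Finset.mem_insert, Finset.mem_singleton]
  by_cases hk : k = j
  · subst hk; simp [h]
  · simp [hk]

namespace BowditchSystem

variable {μ : ℂ} {X : List (Fin n) → Fin n → ℂ} (S : BowditchSystem n μ X)

include S

/-- The geodesic with colours i, j keeps its weight and all others are multiplied by t =
`turnRatio`. So every product of two weights gains a factor t or t² ≤ t. -/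
theorem crossWeight_cons_le (l : List (Fin n)) {i j : Fin n} (hj : j ≠ i)
    (h1 : turnRatio X l i j ≤ 1) :
    crossWeight X (i :: l) j ≤ turnRatio X l i j * crossWeight X l i := by
  have hnot : i ∉ ({i, j} : Finset (Fin n))ᶜ := by simp
  have hnot' : j ∉ ({i, j} : Finset (Fin n))ᶜ := by simp
  have e : ∀ k ∈ ({i, j} : Finset (Fin n))ᶜ,
      geoWeight X (i :: l) j k = turnRatio X l i j * geoWeight X l i k := by
    intro k hk
    simp only [Finset.mem_compl, Finset.mem_insert, Finset.mem_singleton, not_or] at hk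
    exact S.geoWeight_cons l hj hk.1 (Ne.symm hk.2)
  have e' : ∀ k ∈ ({i, j} : Finset (Fin n))ᶜ, geoWeight X (i :: l) j k ^ 2
      = turnRatio X l i j ^ 2 * geoWeight X l i k ^ 2 := fun k hk => by rw [e k hk, mul_pow]
  unfold crossWeight
  rw [compl_singleton_eq_insert hj, compl_singleton_eq_insert hj.symm, Finset.pair_comm j i,
    Finset.sum_insert hnot, Finset.sum_insert hnot, Finset.sum_insert hnot',
    Finset.sum_insert hnot', Finset.sum_congr rfl e, Finset.sum_congr rfl e', ← Finset.mul_sum, ← Finset.mul_sum,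
    S.geoWeight_cons_left]
  have hq : ∑ k ∈ ({i, j} : Finset (Fin n))ᶜ, geoWeight X l i k ^ 2
      ≤ (∑ k ∈ ({i, j} : Finset (Fin n))ᶜ, geoWeight X l i k) ^ 2 :=
    Finset.sum_sq_le_sq_sum_of_nonneg fun k _ => geoWeight_nonneg X l i k
  have t0 := turnRatio_nonneg X l i j
  nlinarith [mul_nonneg (mul_nonneg t0 (sub_nonneg.2 h1)) (sub_nonneg.2 hq)]

theorem edgeWeight_cons_le (l : List (Fin n)) {i j : Fin n} (hj : j ≠ i)
    (h1 : turnRatio X l i j ≤ 1) :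
    edgeWeight X (i :: l) j ≤ turnRatio X l i j * edgeWeight X l i := by
  unfold edgeWeight
  rw [mul_add]
  refine add_le_add (le_of_eq ?_) (S.crossWeight_cons_le l hj h1)
  have h := congrArg norm (S.mul_coProd_cons l hj)
  rw [norm_mul, norm_mul] at h
  have h1 := norm_ne_zero_iff.2 (S.ne_zero l j)
  have h2 := norm_ne_zero_iff.2 (S.ne_zero (i :: l) i)
  have h3 := norm_ne_zero_iff.2 (S.coProd_ne_zero (i :: l) j)
  have h4 := norm_ne_zero_iff.2 (S.coProd_ne_zero l i)
  unfold turnRatio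
  rw [div_mul_div_comm, div_eq_div_iff (by positivity) (by positivity), ← mul_pow, ← h, mul_pow]
  ring

theorem summable_edgeWeight : Summable fun d => edgeSum d (edgeWeight X) := by
  obtain ⟨s, hs1, hs⟩ := S.eventually_sum_turnRatio_le
  obtain ⟨R, hR⟩ := eventually_lenTop.1 hs
  refine summable_of_ratio_norm_eventually_le hs1 (eventually_atTop.2 ⟨R, fun d hd => ?_⟩)
  rw [Real.norm_of_nonneg (edgeSum_nonneg (edgeWeight_nonneg X)),
    Real.norm_of_nonneg (edgeSum_nonneg (edgeWeight_nonneg X)), edgeSum_succ, ← edgeSum_mul_left]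
  refine edgeSum_le fun l i hl hi => ?_
  have h1 := hR l (hl ▸ hd) i hi
  refine le_trans ?_ (mul_le_mul_of_nonneg_right h1 (edgeWeight_nonneg X l i))
  rw [Finset.sum_mul]
  refine Finset.sum_le_sum fun j hj => S.edgeWeight_cons_le l (by simpa using hj) ?_
  exact (Finset.single_le_sum (fun k _ => turnRatio_nonneg X l i k) hj).trans (h1.trans hs1.le)

theorem sum_geoWeight_cons_le {l : List (Fin n)} {i : Fin n}
    (hle : ‖X l i‖ ≤ ‖X (i :: l) i‖) :
    ∑ j ∈ ({i} : Finset (Fin n))ᶜ, ∑ k ∈ ({i} : Finset (Fin n))ᶜ.erase j, geoWeight X (i :: l) j k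
      ≤ crossWeight X l i := by
  unfold crossWeight
  rw [← sum_sum_erase_mul]
  refine Finset.sum_le_sum fun j hj => Finset.sum_le_sum fun k hk => ?_
  simp only [Finset.mem_erase, Finset.mem_compl, Finset.mem_singleton] at hj hk
  rw [S.geoWeight_cons l hj hk.2 hk.1.symm]
  exact mul_le_mul_of_nonneg_right (S.turnRatio_le hj hle) (geoWeight_nonneg _ _ _ _)

/-- A vertex is charged to the edge that leads to it. Each new geodesic there has weight at most the
product of the weights of two geodesics through that edge. -/
theorem eventually_vertex_le : ∀ᶠ l in lenTop n, ∀ i, Red (i :: l) →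
    ‖(∏ k, X (i :: l) k)⁻¹‖ ≤ 2 * edgeWeight X l i ∧ newNorm X (i :: l) ≤ 2 * edgeWeight X l i := by
  filter_upwards [S.eventually_norm_le] with l hl i hi
  have hc := crossWeight_nonneg X l i
  constructor
  · have h1 := S.norm_coProd_le (hl i hi)
    have h4 := norm_pos_iff.2 (S.coProd_ne_zero l i)
    have h2 := norm_pos_iff.2 (S.ne_zero (i :: l) i)
    have h5 : ‖(∏ k, X (i :: l) k)⁻¹‖ ≤ 2 * (1 / ‖coProd X l i‖ ^ 2) := by
      rw [prod_eq_mul_coProd X _ i, S.coProd_cons, norm_inv, norm_mul, inv_eq_one_div,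
        mul_one_div, div_le_div_iff₀ (by positivity) (by positivity)]
      nlinarith
    unfold edgeWeight; linarith
  · have h1 : newNorm X (i :: l) ≤ crossWeight X l i := by
      refine le_trans ?_ (S.sum_geoWeight_cons_le (hl i hi))
      unfold newNorm
      rw [kids_cons hi]
      refine Finset.sum_le_sum fun j hj => Finset.sum_le_sum fun k hk => ?_
      have := norm_eta_le (S.pair_ne (i :: l) j k (Finset.ne_of_mem_erase hk).symm)
      have h0 := geoWeight_nonneg X (i :: l) j k
      unfold geoWeight at *
      linarith
    have h2 : 0 ≤ 1 / ‖coProd X l i‖ ^ 2 := by positivity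
    unfold edgeWeight; linarith

theorem summable_of_eventually_le {f : List (Fin n) → ℝ} (hf : ∀ l, 0 ≤ f l)
    (h : ∀ᶠ l in lenTop n, ∀ i, Red (i :: l) → f (i :: l) ≤ 2 * edgeWeight X l i) :
    Summable fun v : RedWord n => f v.1 := by
  apply summable_of_summable_levels hf
  obtain ⟨R, hR⟩ := eventually_lenTop.1 h
  rw [← summable_nat_add_iff (R + 1)]
  refine Summable.of_nonneg_of_le (fun d => Finset.sum_nonneg fun l _ => hf l) (fun d => ?_)
    (((summable_nat_add_iff R).2 S.summable_edgeWeight).mul_left 2)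
  rw [← add_assoc, sum_sph_succ, ← edgeSum_mul_left]
  exact edgeSum_le fun l i hl hi => hR l (by omega) i hi

theorem summable_norm_inv_prod : Summable fun v : RedWord n => ‖(∏ k, X v.1 k)⁻¹‖ :=
  S.summable_of_eventually_le (f := fun l => ‖(∏ k, X l k)⁻¹‖) (fun _ => norm_nonneg _)
    (S.eventually_vertex_le.mono fun _ h i hi => (h i hi).1)

theorem summable_newNorm : Summable fun v : RedWord n => newNorm X v.1 :=
  S.summable_of_eventually_le (newNorm_nonneg X)
    (S.eventually_vertex_le.mono fun _ h i hi => (h i hi).2)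

/-! ### The identity on balls and its limit -/

theorem sum_div_coProd (l : List (Fin n)) :
    ∑ k, X l k / coProd X l k = 1 + μ * (∏ k, X l k)⁻¹ := by
  have hp : ∏ k, X l k ≠ 0 := Finset.prod_ne_zero_iff.2 fun k _ => S.ne_zero l k
  have e : ∀ k, X l k / coProd X l k = X l k ^ 2 * (∏ k, X l k)⁻¹ := by
    intro k
    rw [prod_eq_mul_coProd X l k]
    have := S.ne_zero l k
    have := S.coProd_ne_zero l k
    field_simp
  simp_rw [e]
  rw [← Finset.sum_mul, ← S.vertex l, sub_mul, mul_inv_cancel₀ hp]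
  ring

theorem div_coProd_cons (l : List (Fin n)) (i : Fin n) :
    X (i :: l) i / coProd X (i :: l) i = 1 - X l i / coProd X l i := by
  have h := S.coProd_ne_zero l i
  rw [S.coProd_cons, eq_sub_iff_add_eq', ← add_div, S.edge, div_self h]

/-- At a new vertex the edge back to the root contributes 1 - u, so the outgoing values add up to u
+ μ/∏ x_k. -/
theorem edgeSum_div_coProd (d : ℕ) :
    edgeSum d (fun l i => X l i / coProd X l i)
      = 1 + ∑ e ∈ Finset.range (d + 1), ∑ l ∈ sph n e, μ * (∏ k, X l k)⁻¹ := by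
  induction d with
  | zero =>
    simp [edgeSum, sph, kids_nil, S.sum_div_coProd]
  | succ d ih =>
    rw [Finset.sum_range_succ, ← add_assoc, ← ih, sum_sph_succ, edgeSum_succ, ← edgeSum_add]
    refine edgeSum_congr fun l i _ _ => ?_
    have h1 := S.sum_div_coProd (i :: l)
    rw [Fintype.sum_eq_add_sum_compl i, S.div_coProd_cons] at h1
    linear_combination h1

/-- A geodesic that enters a vertex from the root side leaves it through one outgoing edge; one
based at the vertex leaves through two. -/
theorem edgeSum_eta (d : ℕ) :
    edgeSum d (fun l i => ∑ j ∈ ({i} : Finset (Fin n))ᶜ, eta (pairProd X l i j))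
      = ∑ e ∈ Finset.range (d + 1), ∑ l ∈ sph n e, newSum X l := by
  induction d with
  | zero =>
    simp only [edgeSum, sph, Finset.sum_singleton, kids_nil, newSum, Finset.range_one,
      zero_add]
    refine Finset.sum_congr rfl fun i _ => Finset.sum_congr ?_ fun _ _ => rfl
    ext k; simp
  | succ d ih =>
    rw [Finset.sum_range_succ, ← ih, sum_sph_succ, edgeSum_succ, ← edgeSum_add]
    refine edgeSum_congr fun l i _ hi => ?_
    unfold newSum
    rw [kids_cons hi, ← Finset.sum_add_distrib]
    refine Finset.sum_congr rfl fun j hj => ?_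
    have hji : j ≠ i := by simpa using hj
    have e : ({j} : Finset (Fin n))ᶜ = insert i (({i} : Finset (Fin n))ᶜ.erase j) := by
      ext k; simp only [Finset.mem_compl, Finset.mem_insert, Finset.mem_singleton, Finset.mem_erase]
      by_cases hk : k = i
      · subst hk; simp [hji.symm]
      · simp [hk]
    rw [e, Finset.sum_insert (by simp), pairProd_comm, S.pairProd_cons]

/-- The defect of an edge, the difference of the two sides of the local identity. -/
theorem defect_mul (l : List (Fin n)) (i : Fin n) :
    (X l i / coProd X l i - ∑ j ∈ ({i} : Finset (Fin n))ᶜ, eta (pairProd X l i j))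
      * (1 - X l i / coProd X l i - ∑ j ∈ ({i} : Finset (Fin n))ᶜ, eta (pairProd X l i j))
      = (∑ j ∈ ({i} : Finset (Fin n))ᶜ, ∑ k ∈ ({i} : Finset (Fin n))ᶜ.erase j,
          eta (pairProd X l i j) * eta (pairProd X l i k)) - μ * (1 / coProd X l i ^ 2) := by
  rw [sum_sum_erase_mul]
  have h := S.coProd_ne_zero l i
  -- η² = η - 1/φ², and 1/φ² is x_j² over the squared product. These terms cancel against the vertex
  -- relation, which evaluates u(1 - u) below.
  have e : ∀ j ∈ ({i} : Finset (Fin n))ᶜ, eta (pairProd X l i j) ^ 2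
      = eta (pairProd X l i j) - X l j ^ 2 * (1 / coProd X l i ^ 2) := by
    intro j hj
    have hji : j ≠ i := by simpa using hj
    have h1 := eta_mul_one_sub (pairProd X l i j)
    have h2 : X l j ^ 2 * (1 / coProd X l i ^ 2) = 1 / pairProd X l i j ^ 2 := by
      rw [coProd_eq_mul_pairProd X l hji.symm, mul_pow]
      have := S.ne_zero l j
      have := S.pairProd_ne_zero hji.symm l
      field_simp
    rw [h2, ← h1]; ring
  have h3 := S.vertex l
  rw [Fintype.sum_eq_add_sum_compl i, prod_eq_mul_coProd X l i] at h3
  have h4 : X l i / coProd X l i - (X l i / coProd X l i) ^ 2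
      = (∑ k ∈ ({i} : Finset (Fin n))ᶜ, X l k ^ 2 - μ) * (1 / coProd X l i ^ 2) := by
    rw [← h3]; field_simp; ring
  rw [Finset.sum_congr rfl e, Finset.sum_sub_distrib, ← Finset.sum_mul]
  linear_combination h4

/-- The values at the ends are u and 1 - u with a common denominator, and |u| ≤ |1 - u| is the
half-plane Re u ≤ 1/2. -/
theorem re_div_coProd_le {l : List (Fin n)} {i : Fin n} (h : ‖X l i‖ ≤ ‖X (i :: l) i‖) :
    (X l i / coProd X l i).re ≤ 1 / 2 := by
  have h1 : ‖X l i / coProd X l i‖ ≤ ‖1 - X l i / coProd X l i‖ := by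
    rw [← S.div_coProd_cons, S.coProd_cons, norm_div, norm_div]
    exact div_le_div_of_nonneg_right h (norm_nonneg _)
  have h2 := pow_le_pow_left₀ (norm_nonneg _) h1 2
  rw [← Complex.normSq_eq_norm_sq, ← Complex.normSq_eq_norm_sq, Complex.normSq_apply,
    Complex.normSq_apply, Complex.sub_re, Complex.sub_im, Complex.one_re, Complex.one_im] at h2
  nlinarith

/-- In `defect_mul` the second factor has real part at least c/2: Re u ≤ 1/2, and the sum of the η
has real part at most 1/2 - c/2, as all but one of them are small. The right-hand side there is
bounded by the edge weight. -/
theorem exists_norm_defect_le : ∃ C, ∀ᶠ l in lenTop n, ∀ i, Red (i :: l) →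
    ‖X l i / coProd X l i - ∑ j ∈ ({i} : Finset (Fin n))ᶜ, eta (pairProd X l i j)‖
      ≤ C * edgeWeight X l i := by
  obtain ⟨c, hc, hre⟩ := S.exists_re_eta_le
  have hn : (0 : ℝ) < n := by have := S.three_le; exact_mod_cast (by omega : 0 < n)
  refine ⟨(1 + ‖μ‖) * (2 / c), ?_⟩
  filter_upwards [S.eventually_norm_le, S.eventually_exists_exceptional (δ := c / n) (by positivity)]
    with l hl hex i hi
  obtain ⟨g, hgi, hg⟩ := hex i hi
  set E := ∑ j ∈ ({i} : Finset (Fin n))ᶜ, eta (pairProd X l i j) with hE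
  have hEre : E.re ≤ 1 / 2 - c / 2 := by
    have hmem : g ∈ ({i} : Finset (Fin n))ᶜ := by simpa using hgi
    rw [hE, Complex.re_sum, ← Finset.add_sum_erase _ _ hmem]
    have h1 := hre l i g hi.tail hgi.symm
    have h2 : ∑ j ∈ ({i} : Finset (Fin n))ᶜ.erase g, (eta (pairProd X l i j)).re ≤ c / 2 := by
      refine (Finset.sum_le_card_nsmul _ _ (c / n / 2) fun j hj => ?_).trans ?_
      · rw [Finset.mem_erase, Finset.mem_compl, Finset.mem_singleton] at hj
        have h3 := (Complex.re_le_norm _).trans (norm_eta_le (S.pair_ne l i j (Ne.symm hj.2)))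
        have h4 := hg j hj.2 hj.1
        unfold geoWeight at h4
        linarith
      · rw [nsmul_eq_mul]
        have : ((({i} : Finset (Fin n))ᶜ.erase g).card : ℝ) ≤ n := by
          exact_mod_cast (Finset.card_le_univ _).trans_eq (Fintype.card_fin n)
        refine (mul_le_mul_of_nonneg_right this (by positivity)).trans_eq ?_
        field_simp
    linarith
  have hlow : c / 2 ≤ ‖1 - X l i / coProd X l i - E‖ := by
    refine le_trans ?_ (Complex.re_le_norm _)
    rw [Complex.sub_re, Complex.sub_re, Complex.one_re]
    have := S.re_div_coProd_le (hl i hi)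
    linarith
  have h := congrArg norm (S.defect_mul l i)
  rw [norm_mul, ← hE] at h
  have h1 : ‖∑ j ∈ ({i} : Finset (Fin n))ᶜ, ∑ k ∈ ({i} : Finset (Fin n))ᶜ.erase j,
      eta (pairProd X l i j) * eta (pairProd X l i k)‖ ≤ crossWeight X l i := by
    unfold crossWeight
    rw [← sum_sum_erase_mul]
    refine (norm_sum_le _ _).trans (Finset.sum_le_sum fun j hj => (norm_sum_le _ _).trans
      (Finset.sum_le_sum fun k hk => ?_))
    have hji : j ≠ i := by simpa using hj
    have hki : k ≠ i := by simpa using Finset.mem_of_mem_erase hk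
    have a0 : ∀ j, j ≠ i → ‖eta (pairProd X l i j)‖ ≤ geoWeight X l i j := by
      intro j hj
      have a1 := norm_eta_le (S.pair_ne l i j hj.symm)
      have a2 := geoWeight_nonneg X l i j
      unfold geoWeight at *
      linarith
    rw [norm_mul]
    exact mul_le_mul (a0 j hji) (a0 k hki) (norm_nonneg _) (geoWeight_nonneg _ _ _ _)
  have h2 : ‖μ * (1 / coProd X l i ^ 2)‖ = ‖μ‖ * (1 / ‖coProd X l i‖ ^ 2) := by
    rw [norm_mul, norm_div, norm_one, norm_pow]
  have h3 := norm_sub_le (∑ j ∈ ({i} : Finset (Fin n))ᶜ, ∑ k ∈ ({i} : Finset (Fin n))ᶜ.erase j,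
      eta (pairProd X l i j) * eta (pairProd X l i k)) (μ * (1 / coProd X l i ^ 2))
  rw [← h, h2] at h3
  have h4 : 0 ≤ 1 / ‖coProd X l i‖ ^ 2 := by positivity
  have h5 := crossWeight_nonneg X l i
  have h6 : ‖X l i / coProd X l i - E‖ * (c / 2) ≤ (1 + ‖μ‖) * edgeWeight X l i := by
    refine (mul_le_mul_of_nonneg_left hlow (norm_nonneg _)).trans (h3.trans ?_)
    unfold edgeWeight
    nlinarith [norm_nonneg μ, mul_nonneg (norm_nonneg μ) h5]
  have h7 : ‖X l i / coProd X l i - E‖ = ‖X l i / coProd X l i - E‖ * (c / 2) * (2 / c) := by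
    field_simp
  rw [h7]
  refine (mul_le_mul_of_nonneg_right h6 (by positivity)).trans_eq ?_
  ring

theorem summable_newSum : Summable fun v : RedWord n => newSum X v.1 :=
  Summable.of_norm_bounded S.summable_newNorm fun v => norm_newSum_le X v.1

theorem summable_mul_inv_prod : Summable fun v : RedWord n => μ * (∏ k, X v.1 k)⁻¹ :=
  (Summable.of_norm S.summable_norm_inv_prod).mul_left μ

/-- The identity as a sum over vertices. -/
theorem tsum_newSum :
    ∑' v : RedWord n, newSum X v.1 = 1 + ∑' v : RedWord n, μ * (∏ k, X v.1 k)⁻¹ := by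
  obtain ⟨C, hC⟩ := S.exists_norm_defect_le
  obtain ⟨R, hR⟩ := eventually_lenTop.1 hC
  have t1 := (tendsto_sum_levels S.summable_newSum).comp (tendsto_add_atTop_nat 1)
  have t2 := ((tendsto_sum_levels (f := fun l => μ * (∏ k, X l k)⁻¹)
    S.summable_mul_inv_prod).comp (tendsto_add_atTop_nat 1)).const_add 1
  have t3 := t2.sub t1
  have t4 : Tendsto (fun d => edgeSum d fun l i => X l i / coProd X l i
      - ∑ j ∈ ({i} : Finset (Fin n))ᶜ, eta (pairProd X l i j)) atTop (𝓝 0) := by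
    have h0 := S.summable_edgeWeight.tendsto_atTop_zero.const_mul C
    rw [mul_zero] at h0
    refine squeeze_zero_norm' (eventually_atTop.2 ⟨R, fun d hd => ?_⟩) h0
    refine (norm_edgeSum_le _ _).trans ?_
    rw [← edgeSum_mul_left]
    exact edgeSum_le fun l i hl hi => hR l (hl ▸ hd) i hi
  simp_rw [edgeSum_sub, S.edgeSum_div_coProd, S.edgeSum_eta] at t4
  exact (sub_eq_zero.1 (tendsto_nhds_unique t3 t4)).symm

end BowditchSystem

/-! ### Geodesics on words and the sum over one geodesic -/

/-- The quotient has the right square. Its real part has the sign of Re((z - z⁻¹) · conj(z + z⁻¹)) =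
|z|² - |z|⁻² > 0. -/
theorem sqrt_eq_div {a z : ℂ} (ha : ∀ t : ℝ, t ∈ Set.Icc (-2 : ℝ) 2 → a ≠ t) (hz : 1 < ‖z‖)
    (hza : z + z⁻¹ = a) : (1 - 4 / a ^ 2) ^ (1 / 2 : ℂ) = (z - z⁻¹) / a := by
  have hz0 : z ≠ 0 := by rintro rfl; norm_num at hz
  have ha0 : a ≠ 0 := by simpa using ha 0 (by norm_num)
  have h1 : ((1 - 4 / a ^ 2) ^ (1 / 2 : ℂ)) ^ 2 = ((z - z⁻¹) / a) ^ 2 := by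
    rw [sqrt_sq, div_pow, eq_div_iff (pow_ne_zero 2 ha0), sub_mul, div_mul_cancel₀ _
      (pow_ne_zero 2 ha0), ← hza]
    linear_combination 4 * mul_inv_cancel₀ hz0
  have hre : 0 < ((z - z⁻¹) / a).re := by
    have hn : 0 < Complex.normSq a := Complex.normSq_pos.2 ha0
    have hlt : Complex.normSq z⁻¹ < Complex.normSq z := by
      rw [Complex.normSq_eq_norm_sq, Complex.normSq_eq_norm_sq, norm_inv]
      have := inv_lt_one_of_one_lt₀ hz
      exact pow_lt_pow_left₀ (this.trans hz) (by positivity) two_ne_zero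
    rw [Complex.div_re, ← add_div]
    refine div_pos ?_ hn
    rw [Complex.normSq_apply, Complex.normSq_apply] at hlt
    rw [← hza, Complex.sub_re, Complex.sub_im, Complex.add_re, Complex.add_im]
    nlinarith
  rcases sq_eq_sq_iff_eq_or_eq_neg.1 h1 with h | h
  · exact h
  · have := sqrt_re_pos (one_sub_mem_slitPlane ha)
    rw [h, Complex.neg_re] at this
    linarith

/-- The two rays of a geodesic both start at its base vertex, whose term is therefore subtracted
once. -/
theorem geodesic_value {a z u v : ℂ} (hz : 1 < ‖z‖) (ha : a ≠ 0) (hu : u ≠ 0) (hv : v ≠ 0)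
    (h1 : leadCoeff z u v ≠ 0) (h2 : leadCoeff z v u ≠ 0) :
    a⁻¹ * (u * leadCoeff z u v * (z - z⁻¹))⁻¹
      + (a⁻¹ * (v * leadCoeff z v u * (z - z⁻¹))⁻¹ - (u * (v * a))⁻¹)
      = (z - z⁻¹) / a / (leadCoeff z u v * leadCoeff z v u * (z - z⁻¹) ^ 2 * z) := by
  have hz0 : z ≠ 0 := by rintro rfl; norm_num at hz
  have hd := sub_inv_ne_zero hz
  have d1 : leadCoeff z u v * (z - z⁻¹) = v - u * z⁻¹ := div_mul_cancel₀ _ hd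
  have d2 : leadCoeff z v u * (z - z⁻¹) = u - v * z⁻¹ := div_mul_cancel₀ _ hd
  have hA : leadCoeff z u v * leadCoeff z v u * (z - z⁻¹) ^ 2 * z
      = (v - u * z⁻¹) * (u - v * z⁻¹) * z := by rw [← d1, ← d2]; ring
  have n1 : v - u * z⁻¹ ≠ 0 := by rw [← d1]; exact mul_ne_zero h1 hd
  have n2 : u - v * z⁻¹ ≠ 0 := by rw [← d2]; exact mul_ne_zero h2 hd
  rw [hA, mul_assoc u, mul_assoc v, d1, d2]
  have hzz := mul_inv_cancel₀ hz0
  generalize z⁻¹ = w at *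
  have key : v * (u - v * w) * z + u * (v - u * w) * z - (v - u * w) * (u - v * w) * z
      = (z - w) * (u * v) := by linear_combination (-u * v * w) * hzz
  rw [div_div, eq_div_iff (by simp [*])]
  field_simp
  linear_combination key

/-- The words on the geodesic with colours `i`, `j` and closest vertex `b` to the root. -/
def geodesicEquiv {i j : Fin n} (hij : i ≠ j) {b : List (Fin n)} (hi : Red (i :: b))
    (hj : Red (j :: b)) : ℕ ⊕ ℕ ≃ {v : RedWord n // strip {i, j} v.1 = b} :=
  Equiv.ofBijective (Sum.elim
    (fun m => ⟨⟨alt i j b m, red_alt hij hi m⟩, strip_alt hi hj m⟩)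
    -- The second ray starts at m + 1, so that the base vertex occurs once.
    (fun m => ⟨⟨alt j i b (m + 1), red_alt hij.symm hj (m + 1)⟩, by
      rw [Finset.pair_comm]; exact strip_alt hj hi (m + 1)⟩)) <| by
    have key : ∀ m m' : ℕ, alt i j b m ≠ alt j i b (m' + 1) := by
      intro m m' h
      have hlen := congrArg List.length h
      rw [length_alt, length_alt, Nat.add_left_cancel_iff] at hlen
      subst hlen
      have h1 : altCol i j m' = altCol j i m' := (List.cons.inj h).1
      by_cases hm : Even m' <;> simp [altCol, hm] at h1
      · exact hij h1
      · exact hij h1.symm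
    have hinj : ∀ (i j : Fin n) (m m' : ℕ), alt i j b m = alt i j b m' → m = m' := by
      intro i j m m' h
      have hlen := congrArg List.length h
      rwa [length_alt, length_alt, Nat.add_left_cancel_iff] at hlen
    constructor
    · rintro (m | m) (m' | m') h <;> simp only [Sum.elim_inl, Sum.elim_inr, Subtype.mk.injEq] at h
      · rw [hinj _ _ _ _ h]
      · exact absurd h (key _ _)
      · exact absurd h.symm (key _ _)
      · rw [Nat.succ_injective (hinj _ _ _ _ h)]
    · rintro ⟨⟨l, hl⟩, hb⟩
      obtain ⟨m, rfl | rfl⟩ := exists_eq_alt hij hl hb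
      · exact ⟨Sum.inl m, rfl⟩
      · cases m with
        | zero => exact ⟨Sum.inl 0, rfl⟩
        | succ m => exact ⟨Sum.inr m, rfl⟩

theorem geodesicEquiv_inl {i j : Fin n} (hij : i ≠ j) {b : List (Fin n)} (hi : Red (i :: b))
    (hj : Red (j :: b)) (m : ℕ) : (geodesicEquiv hij hi hj (Sum.inl m)).1.1 = alt i j b m := rfl

theorem geodesicEquiv_inr {i j : Fin n} (hij : i ≠ j) {b : List (Fin n)} (hi : Red (i :: b))
    (hj : Red (j :: b)) (m : ℕ) :
    (geodesicEquiv hij hi hj (Sum.inr m)).1.1 = alt j i b (m + 1) := rfl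

/-- A sum over unordered pairs as a sum over ordered pairs. -/
theorem sum_sum_erase_eq_sum_colourPair (K : Finset (Fin n)) (e : Fin n → Fin n → ℂ)
    (he : ∀ j k, e j k = e k j) : ∑ j ∈ K, ∑ k ∈ K.erase j, e j k =
      ∑ p : ColourPair n, if p.1.1 ∈ K ∧ p.1.2 ∈ K then 2 * e p.1.1 p.1.2 else 0 := by
  classical
  let f : Fin n → Fin n → ℂ := fun j k => if j ∈ K ∧ k ∈ K then e j k else 0
  have hf : ∀ j k, f j k = f k j := by intro j k; simp only [f, he j k, and_comm]
  have h1 : ∑ j ∈ K, ∑ k ∈ K.erase j, e j k = ∑ j, ∑ k, if j ≠ k then f j k else 0 := by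
    rw [← Finset.sum_filter_add_sum_filter_not Finset.univ (· ∈ K)]
    rw [Finset.sum_eq_zero (s := Finset.univ.filter (· ∉ K)), add_zero]
    · rw [Finset.filter_univ_mem]
      refine Finset.sum_congr rfl fun j hj => ?_
      rw [← Finset.sum_filter]
      symm
      rw [← Finset.sum_subset (s₁ := K.erase j)]
      · exact Finset.sum_congr rfl fun k hk => by
          simp [f, hj, Finset.mem_of_mem_erase hk]
      · intro k hk
        simp [(Finset.ne_of_mem_erase hk).symm]
      · intro k hk hk'
        simp only [Finset.mem_filter, Finset.mem_univ, true_and] at hk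
        have : k ∉ K := fun h => hk' (Finset.mem_erase.2 ⟨hk.symm, h⟩)
        simp [f, this]
    · intro j hj
      simp only [Finset.mem_filter, Finset.mem_univ, true_and] at hj
      simp [f, hj]
  have h2 : ∀ j k, (if j ≠ k then f j k else 0) =
      (if j < k then f j k else 0) + (if k < j then f j k else 0) := by
    intro j k
    rcases lt_trichotomy j k with h | h | h
    · simp [h, h.ne, h.not_gt]
    · simp [h]
    · simp [h, h.ne', h.not_gt]
  have h3 : ∑ j, ∑ k, (if k < j then f j k else 0) = ∑ j, ∑ k, (if j < k then f j k else 0) := by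
    rw [Finset.sum_comm]
    exact Finset.sum_congr rfl fun j _ => Finset.sum_congr rfl fun k _ => by rw [hf]
  have h4 : ∑ j, ∑ k, (if j < k then f j k else 0) = ∑ p : ColourPair n, f p.1.1 p.1.2 := by
    rw [← Fintype.sum_prod_type' (f := fun j k => if j < k then f j k else 0), ← Finset.sum_filter]
    exact Finset.sum_subtype _ (by simp) _
  simp_rw [h1, h2, Finset.sum_add_distrib]
  rw [h3, h4, ← two_mul, Finset.mul_sum]
  refine Finset.sum_congr rfl fun p _ => ?_
  simp only [f, mul_ite, mul_zero]

namespace BowditchSystem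

variable {μ : ℂ} {X : List (Fin n) → Fin n → ℂ} (S : BowditchSystem n μ X)

include S

theorem prod_alt {i j : Fin n} (hij : i ≠ j) (b : List (Fin n)) (m : ℕ) :
    ∏ k, X (alt i j b m) k = pairProd X b i j *
      (X (alt i j b m) (altCol i j m) * X (alt i j b (m + 1)) (altCol i j (m + 1))) := by
  rw [prod_eq_mul_coProd X _ (altCol i j m),
    coProd_eq_mul_pairProd X _ (altCol_succ_ne hij m).symm, S.apply_alt_succ hij,
    ← S.pairProd_alt i j b m]
  have : pairProd X (alt i j b m) (altCol i j m) (altCol i j (m + 1))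
      = pairProd X (alt i j b m) i j := by
    rcases altCol_cases i j m with h | h <;> rw [h.1, h.2]
    rw [pairProd_comm]
  rw [this]; ring

/-- Each of the two rays telescopes by `hasSum_inv_mul_succ`, and the product of the two leading
coefficients brings in σ - μ. -/
theorem hasSum_geodesic {i j : Fin n} (hij : i ≠ j) {b : List (Fin n)} (hi : Red (i :: b))
    (hj : Red (j :: b)) :
    HasSum (fun v : {v : RedWord n // strip {i, j} v.1 = b} => (∏ k, X v.1.1 k)⁻¹)
      ((1 - 4 / pairProd X b i j ^ 2) ^ (1 / 2 : ℂ) / (pairSq X b i j - μ)) := by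
  obtain ⟨z, hz, hza⟩ := exists_one_lt_norm_add_inv_eq (S.pair_ne b i j hij)
  have hsum : Summable fun v : {v : RedWord n // strip {i, j} v.1 = b} => (∏ k, X v.1.1 k)⁻¹ :=
    (Summable.of_norm S.summable_norm_inv_prod).comp_injective Subtype.val_injective
  rw [← (geodesicEquiv hij hi hj).summable_iff] at hsum
  rw [← (geodesicEquiv hij hi hj).hasSum_iff]
  have hz0 : z ≠ 0 := by rintro rfl; norm_num at hz
  have hp := S.pairProd_ne_zero hij b
  have hd := sub_inv_ne_zero hz
  have half : ∀ p q : Fin n, p ≠ q → Red (p :: b) → z + z⁻¹ = pairProd X b p q →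
      Summable (fun m => (∏ k, X (alt p q b m) k)⁻¹) →
      HasSum (fun m => (∏ k, X (alt p q b m) k)⁻¹) ((pairProd X b p q)⁻¹ *
        (X b p * leadCoeff z (X b p) (X b q) * (z - z⁻¹))⁻¹) := by
    intro p q hpq hred hpz hs
    have hpp := S.pairProd_ne_zero hpq b
    have e0 : X (alt p q b 0) (altCol p q 0) = X b p := by rw [alt_zero, altCol_zero]
    have e1 : X (alt p q b 1) (altCol p q 1) = X b q := by
      rw [← zero_add 1, ← S.apply_alt_succ hpq, zero_add, alt_zero, altCol_one]
    have e : (fun m => (∏ k, X (alt p q b m) k)⁻¹) = fun m => (pairProd X b p q)⁻¹ *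
        (X (alt p q b m) (altCol p q m) * X (alt p q b (m + 1)) (altCol p q (m + 1)))⁻¹ := by
      funext m; rw [S.prod_alt hpq, mul_inv]
    rw [e] at hs ⊢
    have := hasSum_inv_mul_succ (y := fun m => X (alt p q b m) (altCol p q m)) hz hpz
      (S.alt_recurrence hpq b)
      (by rw [e0, e1]; exact S.leadCoeff_ne_zero hpq hred.tail hz hpz)
      (fun m => S.ne_zero _ _) ((summable_mul_left_iff (inv_ne_zero hpp)).1 hs)
    rw [e0, e1] at this
    exact this.mul_left _
  have hsl : Summable fun m => (∏ k, X (alt i j b m) k)⁻¹ :=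
    (hsum.comp_injective Sum.inl_injective).congr fun m => by
      simp only [Function.comp_apply, geodesicEquiv_inl]
  have hsr : Summable fun m => (∏ k, X (alt j i b m) k)⁻¹ :=
    (summable_nat_add_iff 1).1 ((hsum.comp_injective Sum.inr_injective).congr fun m => by
      simp only [Function.comp_apply, geodesicEquiv_inr])
  have h1 := half i j hij hi hza hsl
  have h2 := half j i hij.symm hj (by rw [hza, pairProd_comm]) hsr
  rw [← hasSum_nat_add_iff' 1, Finset.sum_range_one, alt_zero] at h2
  have h3 := HasSum.sum (f := (fun v : {v : RedWord n // strip {i, j} v.1 = b} =>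
    (∏ k, X v.1.1 k)⁻¹) ∘ geodesicEquiv hij hi hj)
    (h1.congr_fun fun m => by simp only [Function.comp_apply, geodesicEquiv_inl])
    (h2.congr_fun fun m => by simp only [Function.comp_apply, geodesicEquiv_inr])
  rw [sqrt_eq_div (S.pair_ne b i j hij) hz hza]
  rw [pairProd_comm X b j i, prod_eq_mul_coProd X b i, coProd_eq_mul_pairProd X b hij] at h3
  have hA := leadCoeff_mul_leadCoeff hz hza (X b i) (X b j)
  rw [S.vertex_pair hij, neg_sub] at hA
  rw [← hA, ← geodesic_value hz hp (S.ne_zero b i) (S.ne_zero b j)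
    (S.leadCoeff_ne_zero hij hi.tail hz hza)
    (S.leadCoeff_ne_zero hij.symm hi.tail hz (by rw [hza, pairProd_comm]))]
  exact h3

end BowditchSystem

/-! ### Reduced words and the free product -/

/-- The vertex of a word; the head of the word is the last letter. -/
def toGam : List (Fin n) → Gam n
  | [] => 1
  | i :: l => toGam l * gen i

theorem toGam_cons (i : Fin n) (l : List (Fin n)) : toGam (i :: l) = toGam l * gen i := rfl

theorem toGam_eq_prod (l : List (Fin n)) : toGam l = (l.reverse.map gen).prod := by
  induction l with
  | nil => rfl
  | cons i l ih => rw [toGam_cons, ih, List.reverse_cons, List.map_append, List.prod_append]; simp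

/-- The reduced word in the sense of Mathlib. -/
def toWord (v : RedWord n) : Monoid.CoprodI.Word fun _ : Fin n => Multiplicative (ZMod 2) where
  toList := v.1.reverse.map fun i => ⟨i, Multiplicative.ofAdd 1⟩
  ne_one := by
    intro x hx
    obtain ⟨i, -, rfl⟩ := List.mem_map.1 hx
    have h : Multiplicative.ofAdd (1 : ZMod 2) ≠ 1 := by decide
    exact h
  chain_ne := by
    rw [List.isChain_map, List.isChain_reverse]
    exact v.2.imp fun _ _ h => h.symm

theorem prod_toWord (v : RedWord n) : (toWord v).prod = toGam v.1 := by
  rw [toGam_eq_prod, Monoid.CoprodI.Word.prod]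
  simp only [toWord, List.map_map]
  rfl

theorem toWord_bijective : Function.Bijective (toWord (n := n)) := by
  constructor
  · intro v w h
    have h1 := congrArg Monoid.CoprodI.Word.toList h
    simp only [toWord] at h1
    have h2 := congrArg (List.map Sigma.fst) h1
    simp only [List.map_map, Function.comp_def, List.map_id'] at h2
    exact Subtype.ext (List.reverse_injective h2)
  · intro w
    refine ⟨⟨(w.toList.map Sigma.fst).reverse, ?_⟩, ?_⟩
    · rw [Red, List.isChain_reverse, List.isChain_map]
      exact w.chain_ne.imp fun _ _ h => h.symm
    · apply Monoid.CoprodI.Word.ext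
      simp only [toWord, List.reverse_reverse, List.map_map]
      conv_rhs => rw [← List.map_id w.toList]
      refine List.map_congr_left fun x hx => ?_
      obtain ⟨i, m⟩ := x
      have h := w.ne_one _ hx
      have key : ∀ m : Multiplicative (ZMod 2), m ≠ 1 → Multiplicative.ofAdd 1 = m := by decide
      simp only [Function.comp_apply, id_eq]
      rw [key m h]

/-- Reduced words are in bijection with the vertices. -/
def vertexEquiv (n : ℕ) : RedWord n ≃ Gam n :=
  (Equiv.ofBijective toWord toWord_bijective).trans Monoid.CoprodI.Word.equiv.symm

theorem vertexEquiv_apply (v : RedWord n) : vertexEquiv n v = toGam v.1 := prod_toWord v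

theorem strip_vertexEquiv_symm_mul_gen {I : Finset (Fin n)} {i : Fin n} (hi : i ∈ I) (g : Gam n) :
    strip I ((vertexEquiv n).symm (g * gen i)).1 = strip I ((vertexEquiv n).symm g).1 := by
  obtain ⟨v, rfl⟩ := (vertexEquiv n).surjective g
  rw [Equiv.symm_apply_apply]
  by_cases h : Red (i :: v.1)
  · have : vertexEquiv n v * gen i = vertexEquiv n ⟨i :: v.1, h⟩ := by
      rw [vertexEquiv_apply, vertexEquiv_apply, toGam_cons]
    rw [this, Equiv.symm_apply_apply, strip_cons_of_mem hi]
  · obtain ⟨l, hl⟩ := v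
    cases l with
    | nil => exact absurd (List.isChain_singleton _) h
    | cons k l =>
      have hk : i = k := by
        by_contra hne
        exact h (red_cons_cons.2 ⟨hne, hl⟩)
      subst hk
      have : vertexEquiv n ⟨i :: l, hl⟩ * gen i = vertexEquiv n ⟨l, hl.tail⟩ := by
        rw [vertexEquiv_apply, vertexEquiv_apply, toGam_cons, mul_assoc, gen_mul_gen, mul_one]
      rw [this, Equiv.symm_apply_apply, strip_cons_of_mem hi]

theorem treeAt_mul_gen {I : Finset (Fin n)} {i : Fin n} (hi : i ∈ I) (g : Gam n) :
    treeAt (g * gen i) I = treeAt g I :=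
  (SimpleGraph.ConnectedComponent.sound
    (SimpleGraph.Adj.reachable (G := colourGraph I) ⟨i, hi, rfl⟩)).symm

theorem treeAt_strip (I : Finset (Fin n)) (l : List (Fin n)) :
    treeAt (toGam (strip I l)) I = treeAt (toGam l) I := by
  induction l with
  | nil => rfl
  | cons k l ih =>
    by_cases hk : k ∈ I
    · rw [strip_cons_of_mem hk, ih, toGam_cons, treeAt_mul_gen hk]
    · rw [strip_cons_of_notMem hk]

/-- The stripped word does not change along edges with colour in `I`, so it is an invariant of the
component. -/
theorem strip_eq_of_treeAt_eq {I : Finset (Fin n)} {g h : Gam n} (hgh : treeAt g I = treeAt h I) :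
    strip I ((vertexEquiv n).symm g).1 = strip I ((vertexEquiv n).symm h).1 := by
  have hr : (colourGraph I).Reachable g h := SimpleGraph.ConnectedComponent.exact hgh
  rw [SimpleGraph.reachable_iff_reflTransGen] at hr
  induction hr with
  | refl => rfl
  | tail _ hadj ih =>
    obtain ⟨i, hi, rfl⟩ := hadj
    rw [strip_vertexEquiv_symm_mul_gen hi]
    exact ih (SimpleGraph.ConnectedComponent.sound
      ((SimpleGraph.reachable_iff_reflTransGen _ _).2 (by assumption)))

/-- The vertices that are closest to the root in their `I`-regular subtree. -/
abbrev baseSet (I : Finset (Fin n)) : Set (RedWord n) := {v | ∀ i ∈ I, Red (i :: v.1)}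

/-- The regular subtrees with colour set `I` are in bijection with their base vertices. -/
def treeEquiv (I : Finset (Fin n)) : baseSet I ≃ RegTree I :=
  Equiv.ofBijective (fun v => treeAt (toGam v.1.1) I) <| by
    constructor
    · intro v w h
      have h1 := strip_eq_of_treeAt_eq h
      rw [← vertexEquiv_apply, ← vertexEquiv_apply, Equiv.symm_apply_apply, Equiv.symm_apply_apply,
        strip_eq_self v.2, strip_eq_self w.2] at h1
      exact Subtype.ext (Subtype.ext h1)
    · intro T
      obtain ⟨g, rfl⟩ := Quot.exists_rep T
      obtain ⟨v, rfl⟩ := (vertexEquiv n).surjective g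
      by_cases hI : I.Nonempty
      · obtain ⟨i, hi⟩ := hI
        refine ⟨⟨⟨strip I v.1, (red_cons_strip hi v.2).tail⟩, fun k hk => red_cons_strip hk v.2⟩, ?_⟩
        simp only [treeAt_strip]
        rw [vertexEquiv_apply]; rfl
      · refine ⟨⟨v, fun i hi => absurd ⟨i, hi⟩ hI⟩, ?_⟩
        rw [vertexEquiv_apply]; rfl

theorem treeEquiv_apply (I : Finset (Fin n)) (v : baseSet I) :
    treeEquiv I v = treeAt (toGam v.1.1) I := rfl

/-! ### From Hurwitz maps to systems on words -/

namespace HurwitzMap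

/-- The coordinates of a Hurwitz map at the vertex of a word. -/
def coords (φ : HurwitzMap n) (l : List (Fin n)) (k : Fin n) : ℂ := φ.val k (treeAt (toGam l) {k}ᶜ)

theorem ext_treeAt (φ : HurwitzMap n) (p : ColourPair n) (l : List (Fin n)) :
    φ.ext (p := p) (treeAt (toGam l) p.colours) = pairProd φ.coords l p.1.1 p.1.2 := by
  unfold HurwitzMap.ext pairProd
  exact (Finset.prod_subtype (p := fun k => k ∉ p.colours) _
    (by intro k; simp [ColourPair.colours]) fun k => φ.coords l k).symm

theorem sqSum_treeAt (φ : HurwitzMap n) (p : ColourPair n) (l : List (Fin n)) :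
    φ.sqSum (p := p) (treeAt (toGam l) p.colours) = pairSq φ.coords l p.1.1 p.1.2 := by
  unfold HurwitzMap.sqSum pairSq
  exact (Finset.sum_subtype (p := fun k => k ∉ p.colours) _
    (by intro k; simp [ColourPair.colours]) fun k => φ.coords l k ^ 2).symm

theorem bowditchSystem {μ : ℂ} {φ : HurwitzMap n} (hφ : φ ∈ Bowditch n μ) (hn : 3 ≤ n) :
    BowditchSystem n μ φ.coords where
  three_le := hn
  of_ne l i k h := by
    unfold coords
    rw [toGam_cons, treeAt_mul_gen (by simpa using h.symm)]
  edge l i := φ.edge_rel (toGam l) i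
  vertex l := hφ.1 (toGam l)
  pair_ne := by
    have key : ∀ l (p : ColourPair n), ∀ t : ℝ, t ∈ Set.Icc (-2 : ℝ) 2 →
        pairProd φ.coords l p.1.1 p.1.2 ≠ t := by
      intro l p t ht h
      rw [← φ.ext_treeAt p l] at h
      exact hφ.2.1 ⟨p, _⟩ ⟨t, ht, h⟩
    intro l i j hij
    rcases lt_or_gt_of_ne hij with h | h
    · exact key l ⟨(i, j), h⟩
    · rw [pairProd_comm]; exact key l ⟨(j, i), h⟩
  exists_bound := by
    obtain ⟨K, hK, hfin⟩ := hφ.2.2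
    refine ⟨K, hK, ?_⟩
    obtain ⟨M, hM⟩ := (hfin.image fun γ : AltGeodesic n =>
      ((treeEquiv γ.1.colours).symm γ.2).1.1.length).bddAbove
    have key : ∀ l (p : ColourPair n), M + 1 ≤ l.length → Red (p.1.1 :: l) → Red (p.1.2 :: l) →
        K < ‖pairProd φ.coords l p.1.1 p.1.2‖ := by
      intro l p hl h1 h2
      by_contra hle
      rw [← φ.ext_treeAt p l, not_lt] at hle
      let v : baseSet p.colours := ⟨⟨l, h1.tail⟩, by
        intro i hi
        simp only [ColourPair.colours, Finset.mem_insert, Finset.mem_singleton] at hi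
        rcases hi with rfl | rfl
        · exact h1
        · exact h2⟩
      have h3 := hM ⟨⟨p, treeEquiv p.colours v⟩, hle, rfl⟩
      simp only [Equiv.symm_apply_apply] at h3
      have h4 : v.1.1.length = l.length := rfl
      omega
    rw [eventually_lenTop]
    refine ⟨M + 1, fun l hl i j hij hi hj => ?_⟩
    rcases lt_or_gt_of_ne hij with h | h
    · exact key l ⟨(i, j), h⟩ hl hi hj
    · rw [pairProd_comm]; exact key l ⟨(j, i), h⟩ hl hj hi

theorem summand_treeAt (φ : HurwitzMap n) (μ q : ℂ) (p : ColourPair n) (l : List (Fin n)) :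
    φ.summand μ q (p := p) (treeAt (toGam l) p.colours)
      = 2 * eta (pairProd φ.coords l p.1.1 p.1.2) - q * μ *
        ((1 - 4 / pairProd φ.coords l p.1.1 p.1.2 ^ 2) ^ (1 / 2 : ℂ)
          / (pairSq φ.coords l p.1.1 p.1.2 - μ)) := by
  unfold summand eta
  rw [ext_treeAt, sqSum_treeAt]
  ring

end HurwitzMap

/-! ### Vertex sums regrouped by geodesics -/

namespace BowditchSystem

variable {μ : ℂ} {X : List (Fin n) → Fin n → ℂ} (S : BowditchSystem n μ X)

/-- The contribution of a geodesic to its base vertex. -/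
def baseTerm (X : List (Fin n) → Fin n → ℂ) (p : ColourPair n) (l : List (Fin n)) : ℂ :=
  if p.1.1 ∈ kids l ∧ p.1.2 ∈ kids l then 2 * eta (pairProd X l p.1.1 p.1.2) else 0

theorem newSum_eq (X : List (Fin n) → Fin n → ℂ) (l : List (Fin n)) :
    newSum X l = ∑ p : ColourPair n, baseTerm X p l :=
  sum_sum_erase_eq_sum_colourPair (kids l) (fun j k => eta (pairProd X l j k))
    fun j k => by rw [pairProd_comm]

include S

theorem summable_baseTerm (p : ColourPair n) : Summable fun v : RedWord n => baseTerm X p v.1 := by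
  refine Summable.of_norm_bounded (S.summable_newNorm.mul_left 2) fun v => ?_
  unfold baseTerm
  split_ifs with h
  · rw [norm_mul, Complex.norm_ofNat]
    refine mul_le_mul_of_nonneg_left ?_ (by norm_num)
    unfold newNorm
    refine le_trans ?_ (Finset.single_le_sum
      (fun j _ => Finset.sum_nonneg fun k _ => norm_nonneg _) h.1)
    exact Finset.single_le_sum (f := fun k => ‖eta (pairProd X v.1 p.1.1 k)‖)
      (fun k _ => norm_nonneg _) (Finset.mem_erase.2 ⟨p.2.ne', h.2⟩)
  · rw [norm_zero]
    exact mul_nonneg (by norm_num) (newNorm_nonneg X v.1)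

theorem hasSum_eta_baseSet (p : ColourPair n) :
    HasSum (fun v : baseSet p.colours => 2 * eta (pairProd X v.1.1 p.1.1 p.1.2))
      (∑' v : RedWord n, baseTerm X p v.1) := by
  have h := (S.summable_baseTerm p).hasSum
  rw [← hasSum_subtype_iff_of_support_subset (s := baseSet p.colours)] at h
  · refine h.congr_fun fun v => ?_
    have h1 : p.1.1 ∈ kids v.1.1 ∧ p.1.2 ∈ kids v.1.1 :=
      ⟨mem_kids.2 (v.2 _ (by simp [ColourPair.colours])),
        mem_kids.2 (v.2 _ (by simp [ColourPair.colours]))⟩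
    simp only [Function.comp_apply, baseTerm, if_pos h1]
  · intro v hv
    have h1 : p.1.1 ∈ kids v.1 ∧ p.1.2 ∈ kids v.1 := by
      by_contra hno
      exact hv (if_neg hno)
    intro i hi
    simp only [ColourPair.colours, Finset.mem_insert, Finset.mem_singleton] at hi
    rcases hi with rfl | rfl
    · exact mem_kids.1 h1.1
    · exact mem_kids.1 h1.2

/-- Each vertex lies on exactly one geodesic of the given colours, so the vertex sum is fibred over
geodesics. Its value does not depend on the pair, which is why the weights q are arbitrary. -/
theorem hasSum_sqrt_baseSet (p : ColourPair n) :
    HasSum (fun v : baseSet p.colours => (1 - 4 / pairProd X v.1.1 p.1.1 p.1.2 ^ 2) ^ (1 / 2 : ℂ)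
        / (pairSq X v.1.1 p.1.1 p.1.2 - μ))
      (∑' v : RedWord n, (∏ k, X v.1 k)⁻¹) := by
  have h := (Summable.of_norm S.summable_norm_inv_prod).hasSum
  let π : RedWord n → baseSet p.colours := fun v =>
    ⟨⟨strip p.colours v.1, (red_cons_strip (i := p.1.1) (by simp [ColourPair.colours]) v.2).tail⟩,
      fun i hi => red_cons_strip hi v.2⟩
  rw [← (Equiv.sigmaFiberEquiv π).hasSum_iff] at h
  refine h.sigma fun b => ?_
  have hb := S.hasSum_geodesic p.2.ne (b := b.1.1) (b.2 _ (by simp [ColourPair.colours]))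
    (b.2 _ (by simp [ColourPair.colours]))
  have e : ∀ v : RedWord n, π v = b ↔ strip {p.1.1, p.1.2} v.1 = b.1.1 := fun v => by
    rw [Subtype.ext_iff, Subtype.ext_iff]; rfl
  rw [← (Equiv.subtypeEquivRight e).hasSum_iff] at hb
  exact hb

end BowditchSystem

/-- For n = 2 the empty product gives φ(γ) = 1, against (B1); for n < 2 there are no pairs and the
weights sum to 0. -/
theorem three_le_of_mem_bowditch {μ : ℂ} {φ : HurwitzMap n} (hφ : φ ∈ Bowditch n μ)
    {q : ColourPair n → ℂ} (hq : ∑ p : ColourPair n, q p = 1) : 3 ≤ n := by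
  obtain ⟨p⟩ : Nonempty (ColourPair n) := by
    by_contra h
    rw [not_nonempty_iff] at h
    rw [Finset.univ_eq_empty, Finset.sum_empty] at hq
    exact zero_ne_one hq
  by_contra hn
  refine hφ.2.1 ⟨p, treeAt (toGam []) p.colours⟩ ⟨1, by norm_num, ?_⟩
  have hlt : p.1.1 < p.1.2 := p.2
  have : ({p.1.1, p.1.2} : Finset (Fin n))ᶜ = ∅ := by
    ext k
    simp only [Finset.mem_compl, Finset.mem_insert, Finset.mem_singleton, Finset.notMem_empty,
      iff_false, not_not]
    rw [Fin.ext_iff, Fin.ext_iff]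
    rw [Fin.lt_def] at hlt
    omega
  rw [φ.ext_treeAt, pairProd, this]
  simp

end MarkoffHurwitz
end

theorem theorem4p4 (n : ℕ) (μ : ℂ) (φ : MarkoffHurwitz.HurwitzMap n)
    (hφ : φ ∈ MarkoffHurwitz.Bowditch n μ)
    (q : MarkoffHurwitz.ColourPair n → ℂ)
    (hq : ∑ p : MarkoffHurwitz.ColourPair n, q p = 1) :
    (∀ (p : MarkoffHurwitz.ColourPair n) (γ : MarkoffHurwitz.AltGeodesicOf p),
        φ.ext γ ≠ 0 ∧ φ.sqSum γ ≠ μ) ∧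
    (∀ p : MarkoffHurwitz.ColourPair n,
        Summable fun γ : MarkoffHurwitz.AltGeodesicOf p => ‖φ.summand μ (q p) γ‖) ∧
    ∑ p : MarkoffHurwitz.ColourPair n,
        ∑' γ : MarkoffHurwitz.AltGeodesicOf p, φ.summand μ (q p) γ = 1 := by
  have S := φ.bowditchSystem hφ (MarkoffHurwitz.three_le_of_mem_bowditch hφ hq)
  have h : ∀ p : MarkoffHurwitz.ColourPair n,
      HasSum (fun γ : MarkoffHurwitz.AltGeodesicOf p => φ.summand μ (q p) γ)
        (∑' v : MarkoffHurwitz.RedWord n, MarkoffHurwitz.BowditchSystem.baseTerm φ.coords p v.1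
          - q p * μ * ∑' v : MarkoffHurwitz.RedWord n, (∏ k, φ.coords v.1 k)⁻¹) := by
    intro p
    rw [← (MarkoffHurwitz.treeEquiv p.colours).hasSum_iff]
    refine ((S.hasSum_eta_baseSet p).sub ((S.hasSum_sqrt_baseSet p).mul_left _)).congr_fun
      fun v => ?_
    rw [Function.comp_apply, MarkoffHurwitz.treeEquiv_apply]
    exact φ.summand_treeAt μ (q p) p v.1.1
  refine ⟨fun p γ => ?_, fun p => (h p).summable.norm, ?_⟩
  · obtain ⟨v, rfl⟩ := (MarkoffHurwitz.treeEquiv p.colours).surjective γ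
    rw [MarkoffHurwitz.treeEquiv_apply, φ.ext_treeAt, φ.sqSum_treeAt]
    exact ⟨S.pairProd_ne_zero p.2.ne _, S.pairSq_ne p.2.ne v.1.2⟩
  · simp_rw [fun p => (h p).tsum_eq]
    rw [Finset.sum_sub_distrib, ← Summable.tsum_finsetSum fun p _ => S.summable_baseTerm p]
    simp_rw [← MarkoffHurwitz.BowditchSystem.newSum_eq]
    -- As the weights sum to 1, exactly one copy of μ Σ 1/∏ x_k is subtracted, and 1 remains.
    rw [S.tsum_newSum, tsum_mul_left, ← Finset.sum_mul, ← Finset.sum_mul, hq]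
    ring
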